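/- Let $\mathbf{Graph}$ be the category of finite simple undirected graphs with injective simplicial maps (injective graph homomorphisms). A categorical persistence function on a category is a lower-bounded $\mathbb{Z}$-valued function $p$ on its morphisms such that, for all $u_1\to u_2\to v_1\to v_2$, one has $p(u_1\to v_1)\le p(u_2\to v_1)$, $p(u_2\to v_2)\le p(u_2\to v_1)$ and $p(u_2\to v_1)-p(u_1\to v_1)\ge p(u_2\to v_2)-p(u_1\to v_2)$. On the poset category $(\mathbb{R},\le)$ we write $p(u,v)$ for its value at $u\le v$. An ip-function generator $p$ in $\mathbf{Graph}$ assigns to each functor $M:(\mathbb{R},\le)\to\mathbf{Graph}$ all of whose morphisms are monic a categorical persistence function $p_M$ on $(\mathbb{R},\le)$, with $p_M=p_{M'}$ whenever $M$ and $M'$ are naturally isomorphic. A weighted graph $(G,f)$ is a finite simple graph $G=(V,E)$ with a function $f:E\to\mathbb{R}$; $p_{(G,f)}$ denotes $p_M$ for the filtration $M:u\mapsto G_u$, where $G_u$ is the subgraph of $G$ induced by the edge set $f^{-1}((-\infty,u])$ (these edges and their end points). The generator $p$ is balanced if, for all weighted graphs $(G,f)$, $(G',f')$, every graph isomorphism $\psi:G\to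 G'$ and every real $h>0$ with $\sup_{e\in E}|f(e)-f'(\psi(e))|\le h$, one has $p_{(G,f)}(u-h,v+h)\le p_{(G',f')}(u,v)$ for all real $u<v$. The persistence diagram $D(f)$ of $q=p_{(G,f)}$ is the multiset of points of $\{(u,v)\in\mathbb{R}\times(\mathbb{R}\cup\{+\infty\}) : u\le v\}$ in which every point $(u,u)$ has (countably) infinite multiplicity, a point $(u,v)$ with $u<v<+\infty$ has multiplicity $$\min_{\varepsilon>0,\ u+\varepsilon<v-\varepsilon} \big(q(u+\varepsilon,v-\varepsilon)-q(u-\varepsilon,v-\varepsilon)-q(u+\varepsilon,v+\varepsilon)+q(u-\varepsilon,v+\varepsilon)\big),$$ and a point $(u,+\infty)$ has multiplicity $\min_{\varepsilon>0,\ v>u+\varepsilon}\big(q(u+\varepsilon,v)-q(u-\varepsilon,v)\big)$. The bottleneck distance of two persistence diagrams is $$d(D,D')=\inf_{\gamma}\sup_{x\in D}\|x-\gamma(x)\|_\infty\in[0,+\infty],$$ where $\gamma$ runs over all bijections $D\to D'$ of multisets, with $|\infty-\infty|=0$ and $|\infty-b|=+\infty$ for real $b$. The natural pseudodistance of $(G,f)$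 and $(G',f')$ is $$\delta\big((G,f),(G',f')\big)=\inf_{\phi}\sup_{e\in E}|f(e)-f'(\phi(e))|,$$ where $\phi$ runs over all graph isomorphisms $G\to G'$; it is $+\infty$ if there is none. **Theorem (Stability).** Let $p$ be a balanced ip-function generator in $\mathbf{Graph}$, and let $(G,f)$, $(G',f')$ be two weighted graphs. Then $$d\big(D(f),D(f')\big)\le\delta\big((G,f),(G',f')\big).$$ -/

import Mathlib

open CategoryTheory
open scoped ENNReal

universe w

/-! ### The category of finite simple graphs and injective simplicial maps -/

/-- A finite simple undirected graph (possibly empty). -/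
structure FinGraph : Type (w + 1) where
  /-- The vertices. -/
  V : Type w
  [finite : Finite V]
  /-- The adjacency relation. -/
  graph : SimpleGraph V

/-- Morphisms are the injective simplicial maps. As such a map cannot collapse an edge to a
vertex, these are the injective graph homomorphisms, which Mathlib calls `SimpleGraph.Copy`. -/
instance FinGraph.instCategory : Category FinGraph.{w} where
  Hom G H := SimpleGraph.Copy G.graph H.graph
  id G := SimpleGraph.Copy.id G.graph
  comp f g := SimpleGraph.Copy.comp g f

theorem FinGraph.mono_hom {G H : FinGraph.{w}} (f : G ⟶ H) : Mono f where
  right_cancellation {Z} g h e := by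
    have key : ∀ x : Z.V, (show SimpleGraph.Copy Z.graph G.graph from g) x =
        (show SimpleGraph.Copy Z.graph G.graph from h) x := fun x =>
      (show SimpleGraph.Copy G.graph H.graph from f).injective
        (DFunLike.congr_fun
          (show SimpleGraph.Copy.comp (show SimpleGraph.Copy G.graph H.graph from f) g =
            SimpleGraph.Copy.comp (show SimpleGraph.Copy G.graph H.graph from f) h from e) x)
    exact DFunLike.ext (F := SimpleGraph.Copy Z.graph G.graph) g h key

/-! ### Categorical persistence functions and ip-function generators -/

/-- A categorical persistence function on a category: a lower bounded integer-valued function on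
morphisms such that, for every chain `u₁ ⟶ u₂ ⟶ v₁ ⟶ v₂`, the usual inequalities hold. -/
structure CategoricalPersistenceFunction (C : Type*) [Category C] where
  /-- The value on a morphism. -/
  val : ∀ {u v : C}, (u ⟶ v) → ℤ
  lowerBounded : ∃ m : ℤ, ∀ {u v : C} (f : u ⟶ v), m ≤ val f
  le_left : ∀ {u₁ u₂ v₁ : C} (f : u₁ ⟶ u₂) (g : u₂ ⟶ v₁), val (f ≫ g) ≤ val g
  le_right : ∀ {u₂ v₁ v₂ : C} (g : u₂ ⟶ v₁) (k : v₁ ⟶ v₂), val (g ≫ k) ≤ val g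
  sub_ge_sub : ∀ {u₁ u₂ v₁ v₂ : C} (f : u₁ ⟶ u₂) (g : u₂ ⟶ v₁) (k : v₁ ⟶ v₂),
    val g - val (f ≫ g) ≥ val (g ≫ k) - val (f ≫ g ≫ k)

/-- An `(ℝ, ≤)`-indexed diagram is monic if it sends all morphisms to monomorphisms. -/
def IsMonicDiagram {C : Type*} [Category C] (M : ℝ ⥤ C) : Prop :=
  ∀ {u v : ℝ} (f : u ⟶ v), Mono (M.map f)

/-- An ip-function generator in `C`: it assigns to each monic `(ℝ, ≤)`-indexed diagram a
categorical persistence function on `(ℝ, ≤)`, the same one to naturally isomorphic diagrams. -/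
structure IpFunctionGenerator (C : Type*) [Category C] where
  /-- The persistence function of a monic diagram. -/
  toFun : ∀ M : ℝ ⥤ C, IsMonicDiagram M → CategoricalPersistenceFunction ℝ
  iso_invariant : ∀ (M M' : ℝ ⥤ C) (hM : IsMonicDiagram M) (hM' : IsMonicDiagram M'),
    Nonempty (M ≅ M') → toFun M hM = toFun M' hM'

open Classical in
/-- The value `p(u, v)` at the morphism `u ⟶ v` of `(ℝ, ≤)`, that is, at a pair `u ≤ v`.
(It is only ever used for `u ≤ v`; the value `0` for `v < u` is a convention.) -/
noncomputable def CategoricalPersistenceFunction.at (p : CategoricalPersistenceFunction ℝ)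
    (u v : ℝ) : ℤ :=
  if h : u ≤ v then p.val (homOfLE h) else 0

/-! ### Persistence diagrams and the bottleneck distance -/

/-- A persistence diagram: a multiset of points `(u, v)` of `ℝ × (ℝ ∪ {+∞})` with `u ≤ v`, given
by the multiplicities of its points, in which every diagonal point has infinite multiplicity. -/
structure PersistenceDiagram where
  /-- The multiplicity of a point. -/
  mult : ℝ × WithTop ℝ → ℕ∞
  above : ∀ (u : ℝ) (v : WithTop ℝ), mult (u, v) ≠ 0 → (u : WithTop ℝ) ≤ v
  diagonal : ∀ u : ℝ, mult (u, (u : WithTop ℝ)) = ⊤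

/-- The elements of a persistence diagram counted with multiplicity: a point together with the
index of one of its copies (a point of infinite multiplicity has one copy for each `i : ℕ`). -/
def PersistenceDiagram.Element (D : PersistenceDiagram) : Type :=
  Σ x : ℝ × WithTop ℝ, {i : ℕ // (i : ℕ∞) < D.mult x}

/-- The distance on `ℝ ∪ {+∞}`, with `|∞ - ∞| = 0` and `|∞ - b| = ∞` for real `b`. -/
noncomputable def ordinateDist : WithTop ℝ → WithTop ℝ → ℝ≥0∞
  | (a : ℝ), (b : ℝ) => ENNReal.ofReal |a - b|
  | ⊤, ⊤ => 0
  | _, _ => ⊤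

/-- The distance `‖x - y‖_∞` between points of `ℝ × (ℝ ∪ {+∞})`. -/
noncomputable def pointDist (x y : ℝ × WithTop ℝ) : ℝ≥0∞ :=
  max (ENNReal.ofReal |x.1 - y.1|) (ordinateDist x.2 y.2)

/-- The bottleneck distance: the infimum over all bijections `γ : D → D'` of the supremum of the
displacements `‖x - γ(x)‖_∞`. -/
noncomputable def bottleneckDist (D D' : PersistenceDiagram) : ℝ≥0∞ :=
  ⨅ γ : D.Element ≃ D'.Element, ⨆ x : D.Element, pointDist x.1 (γ x).1

namespace CategoricalPersistenceFunction

/-- The multiplicity of a point `(u, v)` with `u < v < +∞`: the minimum over the `ε > 0` with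
`u + ε < v - ε` of the (nonnegative) number
`p(u+ε, v-ε) - p(u-ε, v-ε) - p(u+ε, v+ε) + p(u-ε, v+ε)`. It is zero if `v ≤ u`. -/
noncomputable def properMult (p : CategoricalPersistenceFunction ℝ) (u v : ℝ) : ℕ :=
  sInf {n : ℕ | ∃ ε : ℝ, 0 < ε ∧ u + ε < v - ε ∧
    (n : ℤ) = p.at (u + ε) (v - ε) - p.at (u - ε) (v - ε)
      - p.at (u + ε) (v + ε) + p.at (u - ε) (v + ε)}

/-- The multiplicity of a point at infinity `(u, +∞)`: the minimum over the `ε > 0` and the real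
`v > u + ε` of the (nonnegative) number `p(u+ε, v) - p(u-ε, v)`. -/
noncomputable def infiniteMult (p : CategoricalPersistenceFunction ℝ) (u : ℝ) : ℕ :=
  sInf {n : ℕ | ∃ ε v : ℝ, 0 < ε ∧ u + ε < v ∧ (n : ℤ) = p.at (u + ε) v - p.at (u - ε) v}

theorem lt_of_properMult_ne_zero (p : CategoricalPersistenceFunction ℝ) {u v : ℝ}
    (h : p.properMult u v ≠ 0) : u < v := by
  by_contra hv
  apply h
  have : {n : ℕ | ∃ ε : ℝ, 0 < ε ∧ u + ε < v - ε ∧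
      (n : ℤ) = p.at (u + ε) (v - ε) - p.at (u - ε) (v - ε)
        - p.at (u + ε) (v + ε) + p.at (u - ε) (v + ε)} = ∅ := by
    ext n
    simp only [Set.mem_ofPred_eq, Set.mem_empty_iff_false, iff_false]
    rintro ⟨ε, h1, h2, -⟩
    linarith
  rw [properMult, this, Nat.sInf_empty]

open Classical in
/-- The multiplicities of the persistence diagram of `p`. -/
noncomputable def diagramMult (p : CategoricalPersistenceFunction ℝ) :
    ℝ × WithTop ℝ → ℕ∞
  | (u, ⊤) => (p.infiniteMult u : ℕ∞)
  | (u, (v : ℝ)) => if u = v then ⊤ else (p.properMult u v : ℕ∞)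

/-- The persistence diagram of a categorical persistence function on `(ℝ, ≤)`. -/
noncomputable def diagram (p : CategoricalPersistenceFunction ℝ) : PersistenceDiagram where
  mult := p.diagramMult
  above u v h := by
    induction v using WithTop.recTopCoe with
    | top => exact le_top
    | coe v =>
      rw [WithTop.coe_le_coe]
      by_cases huv : u = v
      · exact huv.le
      · have h' : (p.properMult u v : ℕ∞) ≠ 0 := by
          have : p.diagramMult (u, (v : WithTop ℝ)) = (p.properMult u v : ℕ∞) := if_neg huv
          rwa [this] at h
        exact (p.lt_of_properMult_ne_zero (by exact_mod_cast h')).le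
  diagonal u := if_pos rfl

end CategoricalPersistenceFunction

/-! ### Weighted graphs and their filtrations -/

/-- A weighted graph `(G, f)`: a finite simple graph with a real weight on each edge. -/
structure WeightedGraph : Type (w + 1) extends FinGraph.{w} where
  /-- The weight `f`. -/
  weight : graph.edgeSet → ℝ

namespace WeightedGraph

/-- The subgraph `G_u` induced by the edges of weight at most `u`: its edges are these edges and
its vertices are their end points. -/
def sublevel (W : WeightedGraph.{w}) (u : ℝ) : W.graph.Subgraph where
  verts := {x | ∃ (y : W.V) (h : W.graph.Adj x y), W.weight ⟨s(x, y), h⟩ ≤ u}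
  Adj x y := ∃ h : W.graph.Adj x y, W.weight ⟨s(x, y), h⟩ ≤ u
  adj_sub h := h.1
  edge_vert {x y} h := ⟨y, h⟩
  symm := ⟨fun x y ⟨h, hu⟩ => ⟨h.symm, by
    have e : (⟨s(y, x), h.symm⟩ : W.graph.edgeSet) = ⟨s(x, y), h⟩ := Subtype.ext Sym2.eq_swap
    rwa [e]⟩⟩

theorem sublevel_mono (W : WeightedGraph.{w}) {u v : ℝ} (h : u ≤ v) :
    W.sublevel u ≤ W.sublevel v :=
  ⟨fun _ ⟨y, hy, hu⟩ => ⟨y, hy, hu.trans h⟩, fun _ _ ⟨hy, hu⟩ => ⟨hy, hu.trans h⟩⟩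

/-- The filtration `u ↦ G_u` with the inclusions, as an `(ℝ, ≤)`-indexed diagram of graphs. -/
def filtration (W : WeightedGraph.{w}) : ℝ ⥤ FinGraph.{w} where
  obj u :=
    { V := (W.sublevel u).verts
      finite := haveI := W.finite; Subtype.finite
      graph := (W.sublevel u).coe }
  map f := ⟨SimpleGraph.Subgraph.inclusion (W.sublevel_mono (leOfHom f)),
    SimpleGraph.Subgraph.inclusion.injective (W.sublevel_mono (leOfHom f))⟩

theorem filtration_isMonic (W : WeightedGraph.{w}) : IsMonicDiagram W.filtration :=
  fun f => FinGraph.mono_hom (W.filtration.map f)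

/-- The supremum over the edges `e` of `G` of `|f(e) - f'(ψ(e))|`, for a graph isomorphism `ψ`
from `G` to `G'`. -/
noncomputable def weightDiff (W W' : WeightedGraph.{w}) (ψ : W.graph ≃g W'.graph) : ℝ≥0∞ :=
  ⨆ e : W.graph.edgeSet, ENNReal.ofReal |W.weight e - W'.weight (ψ.mapEdgeSet e)|

/-- The natural pseudodistance: the infimum of `weightDiff` over all graph isomorphisms. The
infimum over the empty family in `[0, +∞]` is `+∞`, as wanted for non-isomorphic graphs. -/
noncomputable def naturalPseudodist (W W' : WeightedGraph.{w}) : ℝ≥0∞ :=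
  ⨅ ψ : W.graph ≃g W'.graph, weightDiff W W' ψ

end WeightedGraph

namespace IpFunctionGenerator

/-- The ip-function `p_{(G, f)}` of a weighted graph: that of the filtration it produces. -/
def ofWeighted (p : IpFunctionGenerator FinGraph.{w}) (W : WeightedGraph.{w}) :
    CategoricalPersistenceFunction ℝ :=
  p.toFun W.filtration W.filtration_isMonic

/-- An ip-function generator in graphs is balanced if `p_{(G,f)}(u-h, v+h) ≤ p_{(G',f')}(u, v)`
for all `u < v` whenever `h > 0` and there is a graph isomorphism `ψ : G → G'` with
`sup_e |f(e) - f'(ψ(e))| ≤ h`. -/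
def Balanced (p : IpFunctionGenerator FinGraph.{w}) : Prop :=
  ∀ (W W' : WeightedGraph.{w}) (ψ : W.graph ≃g W'.graph) (h : ℝ), 0 < h →
    WeightedGraph.weightDiff W W' ψ ≤ ENNReal.ofReal h →
    ∀ u v : ℝ, u < v → (p.ofWeighted W).at (u - h) (v + h) ≤ (p.ofWeighted W').at u v

end IpFunctionGenerator

/-! ### Jumps of integer-valued monotone functions -/

/-! Fix an isomorphism `ψ` and interpolate linearly between the two weights. Between times `s` and
`t` the weights differ by at most `|s - t| * k`, where `k` is any bound exceeding the supremum of
the differences, so balancedness interleaves the persistence functions at these times by that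
amount.

An interleaving controls multiplicities locally. Near a corner a persistence function is constant on
each open quadrant, so an interleaved function takes the same four values at the corners of a
suitable box (`exists_boxSum_eq_properMult`). A box sum is bracketed by the total multiplicity in
the open and in the closed box (`RankLike.sum_le_boxSum`, `RankLike.exists_boxSum_le_sum`). Hence
cornerpoints off the diagonal neither merge with loss nor vanish, and they move with speed at most
`h`, for any `h > k` (`BoundedMotion`). Points at infinity behave in the same way, with one-variable
jumps in place of box sums.

Following the motion over `[0, 1]` by a supremum argument (`BoundedMotion.sum_le`) yields Hall's
condition for the points whose `h`-ball avoids the diagonal, hence an injection moving them by at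
most `h`. All other proper points are within `h` of the diagonal, where infinitely many copies
receive them. Reversing time gives an injection the other way, and a Schröder–Bernstein argument
that respects the distance bound combines the two into a bijection. Finally `h` tends to the
supremum of the weight differences. -/

open Function in
/-- The jump of a function at a point. -/
noncomputable def jumpAt (g : ℝ → ℤ) (a : ℝ) : ℤ := rightLim g a - leftLim g a

-- The target is discrete, so convergence to a one-sided limit means being eventually equal to it.
open Function Filter Topology in
theorem Monotone.exists_forall_eq_lim {g : ℝ → ℤ} (hg : Monotone g) (a : ℝ) :
    ∃ δ > 0, ∀ s, 0 < s → s < δ → g (a + s) = rightLim g a ∧ g (a - s) = leftLim g a := by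
  have h1 : ∀ᶠ x in 𝓝[>] a, g x = rightLim g a := by
    have := hg.tendsto_rightLim a
    rwa [nhds_discrete, tendsto_pure] at this
  have h2 : ∀ᶠ x in 𝓝[<] a, g x = leftLim g a := by
    have := hg.tendsto_leftLim a
    rwa [nhds_discrete, tendsto_pure] at this
  obtain ⟨b, hb, hb'⟩ := (mem_nhdsGT_iff_exists_Ioo_subset).1 h1
  obtain ⟨c, hc, hc'⟩ := (mem_nhdsLT_iff_exists_Ioo_subset).1 h2
  simp only [Set.mem_Ioi, Set.mem_Iio] at hb hc
  refine ⟨min (b - a) (a - c), lt_min (by linarith) (by linarith), fun s hs hs' => ⟨?_, ?_⟩⟩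
  · exact hb' ⟨by linarith, by linarith [min_le_left (b - a) (a - c)]⟩
  · exact hc' ⟨by linarith [min_le_right (b - a) (a - c)], by linarith⟩

theorem Monotone.exists_forall_sub_eq_jumpAt {g : ℝ → ℤ} (hg : Monotone g) (a : ℝ) :
    ∃ δ > 0, ∀ s, 0 < s → s < δ → g (a + s) - g (a - s) = jumpAt g a := by
  obtain ⟨δ, hδ, h⟩ := hg.exists_forall_eq_lim a
  exact ⟨δ, hδ, fun s hs hs' => by rw [(h s hs hs').1, (h s hs hs').2, jumpAt]⟩

theorem Monotone.sum_jumpAt_le {g : ℝ → ℤ} (hg : Monotone g) (α : ℝ) (T : Finset ℝ) :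
    ∀ β, α ≤ β → (∀ c ∈ T, α < c ∧ c < β) → ∑ c ∈ T, jumpAt g c ≤ g β - g α := by
  induction T using Finset.induction_on_max with
  | empty => intro β hβ _; simpa using hg hβ
  | insert c T hlt ih =>
    intro β hβ hT
    obtain ⟨δ, hδ, h⟩ := hg.exists_forall_eq_lim c
    have hc := hT c (Finset.mem_insert_self _ _)
    have hev : ∃ s, 0 < s ∧ s < δ ∧ α < c - s ∧ ∀ d ∈ T, d < c - s := by
      rcases T.eq_empty_or_nonempty with rfl | hne
      · refine ⟨min (δ / 2) ((c - α) / 2), lt_min (by linarith) (by linarith), ?_, ?_, by simp⟩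
        · linarith [min_le_left (δ / 2) ((c - α) / 2)]
        · linarith [min_le_right (δ / 2) ((c - α) / 2)]
      · have h1 := hlt _ (T.max'_mem hne)
        have h2 := (hT _ (Finset.mem_insert_of_mem (T.max'_mem hne))).1
        refine ⟨min (δ / 2) ((c - T.max' hne) / 2), lt_min (by linarith) (by linarith), ?_, ?_,
          fun d hd => ?_⟩
        · linarith [min_le_left (δ / 2) ((c - T.max' hne) / 2)]
        · linarith [min_le_right (δ / 2) ((c - T.max' hne) / 2)]
        · linarith [min_le_right (δ / 2) ((c - T.max' hne) / 2), T.le_max' d hd]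
    obtain ⟨s, hs, hs', hα, hd⟩ := hev
    have h1 := ih (c - s) hα.le fun d hdT => ⟨(hT d (Finset.mem_insert_of_mem hdT)).1, hd d hdT⟩
    rw [Finset.sum_insert fun hcT => lt_irrefl c (hlt c hcT), jumpAt, ← (h s hs hs').2]
    have h2 := hg.rightLim_le hc.2
    linarith

/-- An integer-valued monotone function grows only by jumping. The induction is on a bound for the
growth: the last point `c` up to which `g` keeps the value `g α` carries a jump, and what remains to
the right of `c` is strictly smaller. -/
theorem Monotone.exists_le_sum_jumpAt {g : ℝ → ℤ} (hg : Monotone g) (β : ℝ) (n : ℕ) :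
    ∀ α ≤ β, g β - g α ≤ n →
      ∃ T : Finset ℝ, (∀ c ∈ T, α ≤ c ∧ c ≤ β) ∧ g β - g α ≤ ∑ c ∈ T, jumpAt g c := by
  induction n using Nat.strong_induction_on with
  | _ n ih =>
    intro α hα hn
    rcases (hg hα).eq_or_lt with heq | hlt
    · exact ⟨∅, by simp, by simp [heq]⟩
    set S : Set ℝ := {x | x ≤ β ∧ g x = g α} with hS
    have hbdd : BddAbove S := ⟨β, fun x hx => hx.1⟩
    have hαS : α ∈ S := ⟨hα, rfl⟩
    set c := sSup S with hc
    have hαc : α ≤ c := le_csSup hbdd hαS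
    have hcβ : c ≤ β := csSup_le ⟨α, hαS⟩ fun x hx => hx.1
    have hleft : Function.leftLim g c ≤ g α := by
      obtain ⟨δ, hδ, h⟩ := hg.exists_forall_eq_lim c
      rw [← (h (δ / 2) (by linarith) (by linarith)).2]
      obtain ⟨x, hx, hx'⟩ := exists_lt_of_lt_csSup ⟨α, hαS⟩
        (show c - δ / 2 < sSup S by rw [← hc]; linarith)
      exact (hg hx'.le).trans_eq hx.2
    rcases hcβ.eq_or_lt with hcb | hcb
    · refine ⟨{c}, by simp [hαc, hcβ], ?_⟩
      rw [Finset.sum_singleton, jumpAt]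
      have := hg.le_rightLim hcb.ge
      linarith
    obtain ⟨δ, hδ, h⟩ := hg.exists_forall_eq_lim c
    set s := min (δ / 2) (β - c) with hs
    have hs0 : 0 < s := lt_min (by linarith) (by linarith)
    have hy := (h s hs0 (by linarith [min_le_left (δ / 2) (β - c)])).1
    have hyβ : c + s ≤ β := by linarith [min_le_right (δ / 2) (β - c)]
    have hylt : g α < g (c + s) := by
      refine lt_of_le_of_ne (hg (by linarith)) fun he => ?_
      have : c + s ≤ c := le_csSup hbdd ⟨hyβ, he.symm⟩
      linarith
    obtain ⟨T, hT, hsum⟩ := ih (g β - g (c + s)).toNat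
      (by have := hg hyβ; omega) (c + s) hyβ (Int.self_le_toNat _)
    refine ⟨insert c T, fun d hd => ?_, ?_⟩
    · rcases Finset.mem_insert.1 hd with rfl | hd
      · exact ⟨hαc, hcβ⟩
      · exact ⟨by linarith [(hT d hd).1], (hT d hd).2⟩
    · rw [Finset.sum_insert fun hcT => by linarith [(hT c hcT).1], jumpAt]
      linarith

theorem Monotone.exists_sub_le_sum_jumpAt {g : ℝ → ℤ} (hg : Monotone g) {α β : ℝ} (h : α ≤ β) :
    ∃ T : Finset ℝ, (∀ c ∈ T, α ≤ c ∧ c ≤ β) ∧ g β - g α ≤ ∑ c ∈ T, jumpAt g c :=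
  hg.exists_le_sum_jumpAt β _ α h (Int.self_le_toNat _)

/-! ### Rank-like functions of two real variables -/

/-- A function of two real variables with the monotonicity properties of a rank function. -/
structure RankLike (F : ℝ → ℝ → ℤ) : Prop where
  mono_left : ∀ v, Monotone fun u => F u v
  anti_right : ∀ u, Antitone (F u)
  sub_anti : ∀ {u u'}, u ≤ u' → Antitone fun v => F u' v - F u v

/-- The alternating sum of the values of `F` at the corners of a rectangle. -/
def boxSum (F : ℝ → ℝ → ℤ) (u₁ u₂ v₁ v₂ : ℝ) : ℤ := F u₂ v₁ - F u₁ v₁ - F u₂ v₂ + F u₁ v₂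

/-- `n` is the multiplicity of the corner `(a, b)` of `F`. -/
def HasCornerMult (F : ℝ → ℝ → ℤ) (a b : ℝ) (n : ℤ) : Prop :=
  ∃ δ > 0, ∀ s, 0 < s → s < δ → boxSum F (a - s) (a + s) (b - s) (b + s) = n

namespace RankLike

variable {F : ℝ → ℝ → ℤ}

theorem boxSum_nonneg (hF : RankLike F) {u₁ u₂ v₁ v₂ : ℝ} (hu : u₁ ≤ u₂) (hv : v₁ ≤ v₂) :
    0 ≤ boxSum F u₁ u₂ v₁ v₂ := by
  have := hF.sub_anti hu hv
  simp only at this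
  simp only [boxSum]
  linarith

/-- Box sums are additive, and the complement of the inner box splits into four boxes: full-height
strips left and right, and one piece each below and above. -/
theorem boxSum_mono (hF : RankLike F) {u₁ u₂ v₁ v₂ u₁' u₂' v₁' v₂' : ℝ}
    (h1 : u₁' ≤ u₁) (hu : u₁ ≤ u₂) (h2 : u₂ ≤ u₂') (h3 : v₁' ≤ v₁) (hv : v₁ ≤ v₂)
    (h4 : v₂ ≤ v₂') : boxSum F u₁ u₂ v₁ v₂ ≤ boxSum F u₁' u₂' v₁' v₂' := by
  have e1 := hF.boxSum_nonneg h1 (h3.trans (hv.trans h4))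
  have e2 := hF.boxSum_nonneg h2 (h3.trans (hv.trans h4))
  have e3 := hF.boxSum_nonneg hu h3
  have e4 := hF.boxSum_nonneg hu h4
  simp only [boxSum] at *
  linarith

theorem monotone_sub_right (hF : RankLike F) {v₁ v₂ : ℝ} (hv : v₁ ≤ v₂) :
    Monotone fun u => F u v₁ - F u v₂ := fun u u' hu => by
  have := hF.sub_anti hu hv
  simp only at *
  linarith

theorem monotone_sub_left (hF : RankLike F) {u₁ u₂ : ℝ} (hu : u₁ ≤ u₂) :
    Monotone fun v => F u₁ v - F u₂ v := fun v v' hv => by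
  have := hF.sub_anti hu hv
  simp only at *
  linarith

/-- Near a vertical line, `F` does not depend on the first variable on either side. -/
theorem exists_eq_of_near (hF : RankLike F) (c v₀ : ℝ) :
    ∃ δ > 0, ∀ s r v, 0 < s → s < δ → 0 < r → r < δ → v₀ ≤ v →
      F (c + s) v = F (c + r) v ∧ F (c - s) v = F (c - r) v := by
  obtain ⟨δ, hδ, h⟩ := (hF.mono_left v₀).exists_forall_eq_lim c
  -- Increments in the first variable are nonnegative and shrink as `v` grows, so the `δ` found on
  -- the line `v = v₀` serves every `v ≥ v₀`.
  have key : ∀ u u' v, u ≤ u' → v₀ ≤ v → F u v₀ = F u' v₀ → F u v = F u' v := by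
    intro u u' v hu hv he
    have h1 : F u' v - F u v ≤ F u' v₀ - F u v₀ := hF.sub_anti hu hv
    have h2 : F u v ≤ F u' v := hF.mono_left v hu
    omega
  refine ⟨δ, hδ, fun s r v hs hs' hr hr' hv => ?_⟩
  obtain ⟨e1, e2⟩ := h s hs hs'
  obtain ⟨e3, e4⟩ := h r hr hr'
  rcases le_total s r with hsr | hsr
  · exact ⟨key _ _ v (by linarith) hv (e1.trans e3.symm),
      (key _ _ v (by linarith) hv (e4.trans e2.symm)).symm⟩
  · exact ⟨(key _ _ v (by linarith) hv (e3.trans e1.symm)).symm,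
      key _ _ v (by linarith) hv (e2.trans e4.symm)⟩

/-- Near a point, `F` is constant on each of the four open quadrants. -/
theorem exists_quadrants (hF : RankLike F) (a b : ℝ) :
    ∃ δ > 0, ∃ c₁ c₂ c₃ c₄ : ℤ, ∀ s r, 0 < s → s < δ → 0 < r → r < δ →
      F (a + s) (b - r) = c₁ ∧ F (a - s) (b - r) = c₂ ∧
      F (a + s) (b + r) = c₃ ∧ F (a - s) (b + r) = c₄ := by
  -- Starting at `b - 1` covers all heights `b ± r` with `r < 1`; the two slices at `a ± δ / 2` then
  -- represent both sides of `a`.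
  obtain ⟨δ, hδ, h⟩ := hF.exists_eq_of_near a (b - 1)
  have hm : ∀ u, Monotone fun v => -F u v := fun u v v' hv => neg_le_neg (hF.anti_right u hv)
  obtain ⟨δ₁, hδ₁, h₁⟩ := (hm (a + δ / 2)).exists_forall_eq_lim b
  obtain ⟨δ₂, hδ₂, h₂⟩ := (hm (a - δ / 2)).exists_forall_eq_lim b
  refine ⟨min (min δ 1) (min δ₁ δ₂), by positivity,
    -Function.leftLim (fun v => -F (a + δ / 2) v) b, -Function.leftLim (fun v => -F (a - δ / 2) v) b,
    -Function.rightLim (fun v => -F (a + δ / 2) v) b,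
    -Function.rightLim (fun v => -F (a - δ / 2) v) b, fun s r hs hs' hr hr' => ?_⟩
  simp only [lt_min_iff] at hs' hr'
  have e1 := h s (δ / 2) (b - r) hs hs'.1.1 (by linarith) (by linarith) (by linarith [hr'.1.2])
  have e2 := h s (δ / 2) (b + r) hs hs'.1.1 (by linarith) (by linarith) (by linarith)
  have e3 := h₁ r hr hr'.2.1
  have e4 := h₂ r hr hr'.2.2
  rw [e1.1, e1.2, e2.1, e2.2]
  simp only [neg_eq_iff_eq_neg] at e3 e4
  exact ⟨e3.2, e4.2, e3.1, e4.1⟩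

/-- The one-variable jump bound is applied twice on the grid spanned by `T`: a jump in `u` is the
box sum of a thin vertical strip, and its jumps in `v` dominate the corner multiplicities. -/
theorem sum_le_boxSum (hF : RankLike F) {m : ℝ × ℝ → ℕ} {u₁ u₂ v₁ v₂ : ℝ} (hu : u₁ ≤ u₂)
    (hv : v₁ ≤ v₂)
    (hm : ∀ x : ℝ × ℝ, u₁ < x.1 → x.1 < u₂ → v₁ < x.2 → x.2 < v₂ →
      HasCornerMult F x.1 x.2 (m x))
    (T : Finset (ℝ × ℝ)) (hT : ∀ x ∈ T, u₁ < x.1 ∧ x.1 < u₂ ∧ v₁ < x.2 ∧ x.2 < v₂) :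
    ((∑ x ∈ T, m x : ℕ) : ℤ) ≤ boxSum F u₁ u₂ v₁ v₂ := by
  have h1 : ∑ c ∈ T.image Prod.fst, jumpAt (fun u => F u v₁ - F u v₂) c ≤
      boxSum F u₁ u₂ v₁ v₂ := by
    refine ((hF.monotone_sub_right hv).sum_jumpAt_le u₁ _ u₂ hu ?_).trans_eq ?_
    · simp only [Finset.mem_image]
      rintro _ ⟨x, hx, rfl⟩
      exact ⟨(hT x hx).1, (hT x hx).2.1⟩
    · simp only [boxSum]; ring
  refine le_trans ?_ h1
  have hsub : T ⊆ T.image Prod.fst ×ˢ T.image Prod.snd := fun x hx =>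
    Finset.mem_product.2 ⟨Finset.mem_image_of_mem _ hx, Finset.mem_image_of_mem _ hx⟩
  refine le_trans (Int.ofNat_le.2 (Finset.sum_le_sum_of_subset hsub)) ?_
  rw [Finset.sum_product]
  push_cast
  refine Finset.sum_le_sum fun c hc => ?_
  have hc' : u₁ < c ∧ c < u₂ := by
    obtain ⟨x, hx, rfl⟩ := Finset.mem_image.1 hc
    exact ⟨(hT x hx).1, (hT x hx).2.1⟩
  obtain ⟨δ, hδ, h⟩ := (hF.monotone_sub_right hv).exists_forall_sub_eq_jumpAt c
  have hδ2 : (0 : ℝ) < δ / 2 := by linarith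
  have hle : c - δ / 2 ≤ c + δ / 2 := by linarith
  have h2 : ∑ d ∈ T.image Prod.snd, jumpAt (fun v => F (c - δ / 2) v - F (c + δ / 2) v) d ≤
      jumpAt (fun u => F u v₁ - F u v₂) c := by
    refine ((hF.monotone_sub_left hle).sum_jumpAt_le v₁ _ v₂ hv ?_).trans_eq ?_
    · simp only [Finset.mem_image]
      rintro _ ⟨x, hx, rfl⟩
      exact (hT x hx).2.2
    · rw [← h (δ / 2) hδ2 (by linarith)]; ring
  refine le_trans (Finset.sum_le_sum fun d hd => ?_) h2
  have hd' : v₁ < d ∧ d < v₂ := by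
    obtain ⟨x, hx, rfl⟩ := Finset.mem_image.1 hd
    exact (hT x hx).2.2
  obtain ⟨δ₁, hδ₁, h₁⟩ := (hF.monotone_sub_left hle).exists_forall_sub_eq_jumpAt d
  obtain ⟨δ₂, hδ₂, h₂⟩ := hm (c, d) hc'.1 hc'.2 hd'.1 hd'.2
  obtain ⟨s, hs, hs'⟩ := exists_between (show 0 < min (δ / 2) (min δ₁ δ₂) by positivity)
  simp only [lt_min_iff] at hs'
  rw [← h₂ s hs hs'.2.2, ← h₁ s hs hs'.2.1]
  refine (hF.boxSum_mono (u₁' := c - δ / 2) (u₂' := c + δ / 2) (v₁' := d - s) (v₂' := d + s)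
    ?_ ?_ ?_ ?_ ?_ ?_).trans_eq ?_ <;> try linarith
  simp only [boxSum]; ring

/-- The same double decomposition in the opposite direction. Jumps may sit on the boundary, so the
box has to be closed. -/
theorem exists_boxSum_le_sum (hF : RankLike F) {m : ℝ × ℝ → ℕ} {u₁ u₂ v₁ v₂ : ℝ} (hu : u₁ ≤ u₂)
    (hv : v₁ ≤ v₂)
    (hm : ∀ x : ℝ × ℝ, u₁ ≤ x.1 → x.1 ≤ u₂ → v₁ ≤ x.2 → x.2 ≤ v₂ →
      HasCornerMult F x.1 x.2 (m x)) :
    ∃ T : Finset (ℝ × ℝ), (∀ x ∈ T, u₁ ≤ x.1 ∧ x.1 ≤ u₂ ∧ v₁ ≤ x.2 ∧ x.2 ≤ v₂) ∧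
      boxSum F u₁ u₂ v₁ v₂ ≤ ((∑ x ∈ T, m x : ℕ) : ℤ) := by
  classical
  obtain ⟨T₁, hT₁, hsum₁⟩ := (hF.monotone_sub_right hv).exists_sub_le_sum_jumpAt hu
  have key : ∀ c ∈ T₁, ∃ T₂ : Finset ℝ, (∀ d ∈ T₂, v₁ ≤ d ∧ d ≤ v₂) ∧
      jumpAt (fun u => F u v₁ - F u v₂) c ≤ ∑ d ∈ T₂, (m (c, d) : ℤ) := by
    intro c hc
    obtain ⟨δ, hδ, h⟩ := (hF.monotone_sub_right hv).exists_forall_sub_eq_jumpAt c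
    -- Monotonicity of box sums points the wrong way here. Independence of the strip's width,
    -- uniformly in `v`, lets the half-width `s` be replaced by the half-height `r`.
    obtain ⟨δ', hδ', h'⟩ := hF.exists_eq_of_near c (v₁ - 1)
    obtain ⟨s, hs, hs'⟩ := exists_between (show 0 < min δ δ' by positivity)
    simp only [lt_min_iff] at hs'
    have hle : c - s ≤ c + s := by linarith
    obtain ⟨T₂, hT₂, hsum₂⟩ := (hF.monotone_sub_left hle).exists_sub_le_sum_jumpAt hv
    refine ⟨T₂, hT₂, ?_⟩
    rw [← h s hs hs'.1]
    refine le_trans (le_of_eq (by ring)) (hsum₂.trans (Finset.sum_le_sum fun d hd => ?_))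
    obtain ⟨δ₁, hδ₁, h₁⟩ := (hF.monotone_sub_left hle).exists_forall_sub_eq_jumpAt d
    obtain ⟨δ₂, hδ₂, h₂⟩ := hm (c, d) (hT₁ c hc).1 (hT₁ c hc).2 (hT₂ d hd).1 (hT₂ d hd).2
    obtain ⟨r, hr, hr'⟩ := exists_between (show 0 < min (min δ' 1) (min δ₁ δ₂) by positivity)
    simp only [lt_min_iff] at hr'
    rw [← h₁ r hr hr'.2.1, ← h₂ r hr hr'.2.2]
    have hd1 := (hT₂ d hd).1
    have e1 := h' s r (d - r) hs hs'.2 hr hr'.1.1 (by linarith [hr'.1.2])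
    have e2 := h' s r (d + r) hs hs'.2 hr hr'.1.1 (by linarith [hr'.1.2])
    simp only [boxSum]
    rw [e1.1, e1.2, e2.1, e2.2]
    linarith
  choose! T₂ hT₂ hsum₂ using key
  refine ⟨T₁ ×ˢ T₁.biUnion T₂, ?_, ?_⟩
  · rintro ⟨c, d⟩ hx
    simp only [Finset.mem_product, Finset.mem_biUnion] at hx
    obtain ⟨hc, c', hc', hd⟩ := hx
    exact ⟨(hT₁ c hc).1, (hT₁ c hc).2, hT₂ c' hc' d hd⟩
  · rw [Finset.sum_product]
    push_cast
    refine le_trans (le_of_eq (by simp only [boxSum]; ring)) (hsum₁.trans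
      (Finset.sum_le_sum fun c hc => (hsum₂ c hc).trans ?_))
    exact Finset.sum_le_sum_of_subset_of_nonneg (Finset.subset_biUnion_of_mem T₂ hc)
      fun _ _ _ => Nat.cast_nonneg _

end RankLike

/-! ### Matching points that move continuously -/

theorem unitInterval_induction {P : ℝ → Prop} (h0 : P 0)
    (hleft : ∀ t, 0 < t → t ≤ 1 → (∀ ε > 0, ∃ s, 0 ≤ s ∧ t - ε < s ∧ s < t ∧ P s) → P t)
    (hright : ∀ t, 0 ≤ t → t < 1 → P t → ∃ s, t < s ∧ s ≤ 1 ∧ P s) : P 1 := by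
  set S : Set ℝ := {t | 0 ≤ t ∧ t ≤ 1 ∧ P t} with hS
  have hbdd : BddAbove S := ⟨1, fun x hx => hx.2.1⟩
  have h0S : (0 : ℝ) ∈ S := ⟨le_rfl, zero_le_one, h0⟩
  set c := sSup S with hc
  have hc0 : 0 ≤ c := le_csSup hbdd h0S
  have hc1 : c ≤ 1 := csSup_le ⟨0, h0S⟩ fun x hx => hx.2.1
  have hPc : P c := by
    by_contra hPc
    have hpos : 0 < c := lt_of_le_of_ne hc0 fun h => hPc (h ▸ h0)
    refine hPc (hleft c hpos hc1 fun ε hε => ?_)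
    obtain ⟨s, hs, hs'⟩ := exists_lt_of_lt_csSup ⟨0, h0S⟩
      (show c - ε < sSup S by rw [← hc]; linarith)
    exact ⟨s, hs.1, hs', lt_of_le_of_ne (le_csSup hbdd hs) fun h => hPc (h ▸ hs.2.2), hs.2.2⟩
  rcases hc1.eq_or_lt with h | h
  · rwa [h] at hPc
  · obtain ⟨s, hs, hs1, hPs⟩ := hright c hc0 h hPc
    exact absurd (le_csSup hbdd (show s ∈ S from ⟨by linarith, hs1, hPs⟩)) (not_le.2 hs)

section Motion

variable {Y : Type*} [MetricSpace Y] {m : ℝ → Y → ℕ} {U : Set Y} {h : ℝ}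

/-- Points with multiplicities `m t` depending on a time `t ∈ [0, 1]` which, as long as they are
in `U`, move with speed at most `h`. -/
structure BoundedMotion (m : ℝ → Y → ℕ) (U : Set Y) (h : ℝ) : Prop where
  upper : ∀ t, 0 ≤ t → t ≤ 1 → ∀ p ∈ U, ∃ ρ > 0, ∀ s, 0 ≤ s → s ≤ 1 → |s - t| < ρ →
    ∀ T : Finset Y, (∀ y ∈ T, dist y p < ρ) → ∑ y ∈ T, m s y ≤ m t p
  lower : ∀ t, 0 ≤ t → t < 1 → ∀ p ∈ U, ∃ ρ > 0, ∀ s, t < s → s ≤ 1 → s - t < ρ →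
    ∃ T : Finset Y, (∀ y ∈ T, dist y p ≤ (s - t) * h) ∧ m t p ≤ ∑ y ∈ T, m s y

theorem Finset.exists_pos_forall_le {ι : Type*} (T : Finset ι) (ρ : ι → ℝ)
    (hρ : ∀ i ∈ T, 0 < ρ i) : ∃ ε > 0, ∀ i ∈ T, ε ≤ ρ i := by
  rcases T.eq_empty_or_nonempty with rfl | hT
  · exact ⟨1, one_pos, by simp⟩
  · obtain ⟨i, hi, hmin⟩ := T.exists_min_image ρ hT
    exact ⟨ρ i, hρ i hi, hmin⟩

theorem Finset.sum_biUnion_le_sum_sum {ι κ : Type*} [DecidableEq κ] (P : Finset ι)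
    (A : ι → Finset κ) (f : κ → ℕ) : ∑ y ∈ P.biUnion A, f y ≤ ∑ p ∈ P, ∑ y ∈ A p, f y := by
  classical
  induction P using Finset.induction_on with
  | empty => simp
  | insert p P hp ih =>
    rw [Finset.biUnion_insert, Finset.sum_insert hp]
    have := Finset.sum_union_inter (s₁ := A p) (s₂ := P.biUnion A) (f := f)
    omega

/-- This is Hall's condition for the matching. The set of times `t` by which the mass of `K` is
still found within `t * h` of `K` is closed under limits from the left by `upper` and can be
extended to the right by `lower`. -/
theorem BoundedMotion.sum_le [ProperSpace Y] (hm : BoundedMotion m U h) (hh : 0 < h)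
    (K : Finset Y) (hK : ∀ x ∈ K, Metric.closedBall x h ⊆ U) :
    ∃ T : Finset Y, (∀ y ∈ T, ∃ x ∈ K, dist y x ≤ h) ∧ ∑ x ∈ K, m 0 x ≤ ∑ y ∈ T, m 1 y := by
  classical
  have main := unitInterval_induction
    (P := fun t => ∃ T : Finset Y, (∀ y ∈ T, ∃ x ∈ K, dist y x ≤ t * h) ∧
      ∑ x ∈ K, m 0 x ≤ ∑ y ∈ T, m t y) ?_ ?_ ?_
  · simpa using main
  · exact ⟨K, fun y hy => ⟨y, hy, by simp⟩, le_rfl⟩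
  · intro t ht ht1 hs
    -- At a limit time, all mass slightly earlier lies in this compact set; finitely many balls
    -- cover it, and `upper` collects the mass of each ball at its centre.
    set C : Set Y := ⋃ x ∈ K, Metric.closedBall x (t * h) with hC
    have hCU : C ⊆ U := Set.iUnion₂_subset fun x hx =>
      (Metric.closedBall_subset_closedBall (by nlinarith)).trans (hK x hx)
    have hCc : IsCompact C := K.isCompact_biUnion fun x _ => isCompact_closedBall x (t * h)
    choose! ρ hρ hup using fun p (hp : p ∈ C) => hm.upper t ht.le ht1 p (hCU hp)
    obtain ⟨P, hPC, hcov⟩ := hCc.elim_nhds_subcover (fun p => Metric.ball p (ρ p))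
      fun p hp => Metric.ball_mem_nhds p (hρ p hp)
    obtain ⟨ε, hε, hερ⟩ := P.exists_pos_forall_le ρ fun p hp => hρ p (hPC p hp)
    obtain ⟨s, hs0, hs1, hst, T, hT, hsum⟩ := hs ε hε
    refine ⟨P, fun p hp => by simpa [hC] using hPC p hp, hsum.trans ?_⟩
    have hsub : T ⊆ P.biUnion fun p => T.filter fun y => dist y p < ρ p := by
      intro y hy
      obtain ⟨x, hx, hyx⟩ := hT y hy
      have hyC : y ∈ C := Set.mem_iUnion₂.2 ⟨x, hx, hyx.trans (by nlinarith)⟩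
      obtain ⟨p, hp, hyp⟩ := Set.mem_iUnion₂.1 (hcov hyC)
      exact Finset.mem_biUnion.2 ⟨p, hp, Finset.mem_filter.2 ⟨hy, hyp⟩⟩
    refine (Finset.sum_le_sum_of_subset hsub).trans
      ((Finset.sum_biUnion_le_sum_sum _ _ _).trans (Finset.sum_le_sum fun p hp => ?_))
    refine hup p (hPC p hp) s hs0 (by linarith) ?_ _ fun y hy => (Finset.mem_filter.1 hy).2
    rw [abs_lt]
    constructor <;> linarith [hερ p hp]
  · rintro t ht0 ht1 ⟨T, hT, hsum⟩
    have hTU : ∀ y ∈ T, y ∈ U := fun y hy => by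
      obtain ⟨x, hx, hyx⟩ := hT y hy
      exact hK x hx (hyx.trans (by nlinarith))
    choose! ρ hρ hlow using fun y (hy : y ∈ T) => hm.lower t ht0 ht1 y (hTU y hy)
    obtain ⟨ε, hε, hερ⟩ := T.exists_pos_forall_le ρ hρ
    -- The time step is short enough for the sets reached from distinct points of `T` to be
    -- disjoint, so that no mass is counted twice.
    obtain ⟨ε', hε', hsep⟩ := T.offDiag.exists_pos_forall_le (fun z => dist z.1 z.2)
      fun z hz => dist_pos.2 (Finset.mem_offDiag.1 hz).2.2
    obtain ⟨r, hr, hr'⟩ := exists_between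
      (show 0 < min (min ε (1 - t)) (ε' / (2 * h)) from
        lt_min (lt_min hε (by linarith)) (by positivity))
    simp only [lt_min_iff] at hr'
    have hrh : 2 * (r * h) < ε' := by
      have := (lt_div_iff₀ (by positivity)).1 hr'.2
      linarith
    have hex : ∀ y ∈ T, ∃ T' : Finset Y, (∀ z ∈ T', dist z y ≤ r * h) ∧
        m t y ≤ ∑ z ∈ T', m (t + r) z := fun y hy => by
      have := hlow y hy (t + r) (by linarith) (by linarith) (by linarith [hερ y hy])
      simpa using this
    choose! T' hT' hsum' using hex
    refine ⟨t + r, by linarith, by linarith, T.biUnion T', fun z hz => ?_, ?_⟩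
    · obtain ⟨y, hy, hz⟩ := Finset.mem_biUnion.1 hz
      obtain ⟨x, hx, hyx⟩ := hT y hy
      exact ⟨x, hx, (dist_triangle z y x).trans (by linarith [hT' y hy z hz])⟩
    · rw [Finset.sum_biUnion]
      · exact hsum.trans (Finset.sum_le_sum hsum')
      · intro y hy y' hy' hne
        refine Finset.disjoint_left.2 fun z hz hz' => ?_
        have h1 := hsep (y, y') (Finset.mem_offDiag.2 ⟨hy, hy', hne⟩)
        have h2 := dist_triangle_left y y' z
        linarith [hT' y hy z hz, hT' y' hy' z hz']

theorem BoundedMotion.finite_ne_zero [ProperSpace Y] (hm : BoundedMotion m U h) {C : Set Y}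
    (hC : IsCompact C) (hCU : C ⊆ U) : {y ∈ C | m 1 y ≠ 0}.Finite := by
  classical
  choose! ρ hρ hup using fun p (hp : p ∈ C) => hm.upper 1 zero_le_one le_rfl p (hCU hp)
  obtain ⟨P, hPC, hcov⟩ := hC.elim_nhds_subcover (fun p => Metric.ball p (ρ p))
    fun p hp => Metric.ball_mem_nhds p (hρ p hp)
  refine (P.finite_toSet.biUnion (t := fun p => {y ∈ Metric.ball p (ρ p) | m 1 y ≠ 0})
    fun p hp => ?_).subset fun y hy => ?_
  · by_contra hinf
    obtain ⟨T, hT, hcard⟩ := Set.Infinite.exists_subset_card_eq hinf (m 1 p + 1)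
    have h1 := hup p (hPC p hp) 1 zero_le_one le_rfl (by simpa using hρ p (hPC p hp)) T
      fun y hy => (hT hy).1
    have h2 : T.card ≤ ∑ y ∈ T, m 1 y := by
      rw [Finset.card_eq_sum_ones]
      exact Finset.sum_le_sum fun y hy => Nat.one_le_iff_ne_zero.2 (hT hy).2
    omega
  · obtain ⟨p, hp, hyp⟩ := Set.mem_iUnion₂.1 (hcov hy.1)
    exact Set.mem_iUnion₂.2 ⟨p, hp, hyp, hy.2⟩

/-- The points at time `0` that stay in `U` can be matched injectively with points at time `1`. -/
theorem BoundedMotion.exists_injective [ProperSpace Y] (hm : BoundedMotion m U h) (hh : 0 < h) :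
    ∃ φ : {e : Σ y, Fin (m 0 y) // Metric.closedBall e.1 h ⊆ U} → Σ y, Fin (m 1 y),
      Function.Injective φ ∧ ∀ e, dist (φ e).1 e.1.1 ≤ h := by
  classical
  have hfin : ∀ e : {e : Σ y, Fin (m 0 y) // Metric.closedBall e.1 h ⊆ U},
      {z : Σ y, Fin (m 1 y) | dist z.1 e.1.1 ≤ h}.Finite := fun e => by
    refine (Set.Finite.biUnion (hm.finite_ne_zero (isCompact_closedBall e.1.1 h) e.2)
      (t := fun y => Set.range (Sigma.mk y)) fun y _ => Set.finite_range _).subset ?_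
    intro z hz
    exact Set.mem_iUnion₂.2 ⟨z.1, ⟨hz, Nat.ne_of_gt z.2.pos⟩, z.2, rfl⟩
  -- Hall's marriage theorem for an infinite family of finite sets. Including every copy of a chosen
  -- point only strengthens the condition, so `sum_le` on the underlying points suffices.
  have hall := (Finset.all_card_le_biUnion_card_iff_exists_injective
    fun e => (hfin e).toFinset).1 ?_
  · obtain ⟨φ, hφ, hφ'⟩ := hall
    exact ⟨φ, hφ, fun e => by simpa using hφ' e⟩
  intro A
  obtain ⟨T, hT, hsum⟩ := hm.sum_le hh (A.image fun e => e.1.1) (by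
    simp only [Finset.mem_image]
    rintro _ ⟨e, -, rfl⟩
    exact e.2)
  calc A.card = (A.image Subtype.val).card :=
        (Finset.card_image_of_injective _ Subtype.val_injective).symm
    _ ≤ ((A.image fun e => e.1.1).sigma fun y => (Finset.univ : Finset (Fin (m 0 y)))).card := by
        refine Finset.card_le_card fun z hz => ?_
        obtain ⟨e, he, rfl⟩ := Finset.mem_image.1 hz
        exact Finset.mem_sigma.2 ⟨Finset.mem_image.2 ⟨e, he, rfl⟩, Finset.mem_univ _⟩
    _ = ∑ x ∈ A.image fun e => e.1.1, m 0 x := by simp [Finset.card_sigma]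
    _ ≤ ∑ y ∈ T, m 1 y := hsum
    _ = (T.sigma fun y => (Finset.univ : Finset (Fin (m 1 y)))).card := by
        simp [Finset.card_sigma]
    _ ≤ _ := by
        refine Finset.card_le_card fun z hz => ?_
        obtain ⟨x, hx, hzx⟩ := hT z.1 (Finset.mem_sigma.1 hz).1
        obtain ⟨e, he, rfl⟩ := Finset.mem_image.1 hx
        exact Finset.mem_biUnion.2 ⟨e, he, by simpa using hzx⟩

end Motion

/-! ### Persistence diagrams as jumps -/

namespace CategoricalPersistenceFunction

variable (q : CategoricalPersistenceFunction ℝ)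

theorem at_of_le {u v : ℝ} (h : u ≤ v) : q.at u v = q.val (homOfLE h) := dif_pos h

theorem at_mono_left {u u' v : ℝ} (h : u ≤ u') (h' : u' ≤ v) : q.at u v ≤ q.at u' v := by
  rw [q.at_of_le h', q.at_of_le (h.trans h')]
  exact q.le_left (homOfLE h) (homOfLE h')

theorem at_anti_right {u v v' : ℝ} (h : u ≤ v) (h' : v ≤ v') : q.at u v' ≤ q.at u v := by
  rw [q.at_of_le h, q.at_of_le (h.trans h')]
  exact q.le_right (homOfLE h) (homOfLE h')

theorem at_sub_le {u u' v v' : ℝ} (h₁ : u ≤ u') (h₂ : u' ≤ v) (h₃ : v ≤ v') :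
    q.at u' v' - q.at u v' ≤ q.at u' v - q.at u v := by
  rw [q.at_of_le h₂, q.at_of_le (h₁.trans h₂), q.at_of_le (h₂.trans h₃),
    q.at_of_le (h₁.trans (h₂.trans h₃))]
  exact q.sub_ge_sub (homOfLE h₁) (homOfLE h₂) (homOfLE h₃)

/-- The extension to the plane of the restriction of `q` to the quadrant `u ≤ w ≤ v`. -/
noncomputable def clamp (w u v : ℝ) : ℤ := q.at (min u w) (max v w)

/-- After clamping, the first argument never exceeds `w` and the second is never below it, so the
rank inequalities hold on the whole plane, free of side conditions. -/
theorem rankLike_clamp (w : ℝ) : RankLike (q.clamp w) where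
  mono_left _ _ _ h := q.at_mono_left (min_le_min_right w h)
    ((min_le_right _ _).trans (le_max_right _ _))
  anti_right _ _ _ h := q.at_anti_right ((min_le_right _ _).trans (le_max_right _ _))
    (max_le_max_right w h)
  sub_anti h _ _ h' := q.at_sub_le (min_le_min_right w h)
    ((min_le_right _ _).trans (le_max_right _ _)) (max_le_max_right w h')

theorem clamp_of_le {w u v : ℝ} (h : u ≤ w) (h' : w ≤ v) : q.clamp w u v = q.at u v := by
  rw [clamp, min_eq_left h, max_eq_left h']

theorem boxSum_clamp {w u₁ u₂ v₁ v₂ : ℝ} (h₁ : u₁ ≤ u₂) (h₂ : u₂ ≤ w) (h₃ : w ≤ v₁)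
    (h₄ : v₁ ≤ v₂) : boxSum (q.clamp w) u₁ u₂ v₁ v₂ = boxSum q.at u₁ u₂ v₁ v₂ := by
  simp only [boxSum]
  rw [q.clamp_of_le h₂ h₃, q.clamp_of_le (h₁.trans h₂) h₃, q.clamp_of_le h₂ (h₃.trans h₄),
    q.clamp_of_le (h₁.trans h₂) (h₃.trans h₄)]

/-- The minimum over `ε` is attained, and box sums decrease with the box, so every smaller `ε`
attains it too. Clamping at the midpoint admits all `ε` in the definition; the result then passes to
`w` for small boxes. -/
theorem hasCornerMult_clamp {a b w : ℝ} (ha : a < w) (hb : w < b) :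
    HasCornerMult (q.clamp w) a b (q.properMult a b) := by
  set S := {n : ℕ | ∃ ε : ℝ, 0 < ε ∧ a + ε < b - ε ∧
    (n : ℤ) = boxSum q.at (a - ε) (a + ε) (b - ε) (b + ε)} with hS
  have hF := q.rankLike_clamp ((a + b) / 2)
  have hbox : ∀ ε, 0 < ε → a + ε < b - ε →
      boxSum (q.clamp ((a + b) / 2)) (a - ε) (a + ε) (b - ε) (b + ε) =
        boxSum q.at (a - ε) (a + ε) (b - ε) (b + ε) := fun ε h h' =>
    q.boxSum_clamp (by linarith) (by linarith) (by linarith) (by linarith)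
  have hmem : ∀ ε, 0 < ε → a + ε < b - ε →
      (boxSum q.at (a - ε) (a + ε) (b - ε) (b + ε)).toNat ∈ S := fun ε h h' => by
    refine ⟨ε, h, h', Int.toNat_of_nonneg ?_⟩
    rw [← hbox ε h h']
    exact hF.boxSum_nonneg (by linarith) (by linarith)
  obtain ⟨ε, hε, hε', he⟩ : q.properMult a b ∈ S :=
    Nat.sInf_mem ⟨_, hmem ((b - a) / 4) (by linarith) (by linarith)⟩
  refine ⟨min ε (min (w - a) (b - w)), lt_min hε (lt_min (by linarith) (by linarith)),
    fun s hs hs' => ?_⟩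
  simp only [lt_min_iff] at hs'
  rw [q.boxSum_clamp (by linarith) (by linarith) (by linarith) (by linarith)]
  have hs'' : a + s < b - s := by linarith
  refine le_antisymm ?_ ?_
  · rw [he, ← hbox s hs hs'', ← hbox ε hε hε']
    apply hF.boxSum_mono <;> linarith
  · have h1 : q.properMult a b ≤ _ := Nat.sInf_le (hmem s hs hs'')
    have h2 := hF.boxSum_nonneg (show a - s ≤ a + s by linarith) (show b - s ≤ b + s by linarith)
    rw [hbox s hs hs''] at h2
    omega

/-- The limit of `q.at u v` as `v` tends to infinity. -/
noncomputable def limTop (u : ℝ) : ℤ := sInf {n : ℤ | ∃ v, u ≤ v ∧ q.at u v = n}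

theorem exists_forall_at_eq_limTop (u : ℝ) : ∃ V, u ≤ V ∧ ∀ v, V ≤ v → q.at u v = q.limTop u := by
  obtain ⟨m, hm⟩ := q.lowerBounded
  have hbdd : BddBelow {n : ℤ | ∃ v, u ≤ v ∧ q.at u v = n} := by
    refine ⟨m, ?_⟩
    rintro _ ⟨v, hv, rfl⟩
    rw [q.at_of_le hv]
    exact hm _
  have hne : {n : ℤ | ∃ v, u ≤ v ∧ q.at u v = n}.Nonempty := ⟨q.at u u, u, le_rfl, rfl⟩
  obtain ⟨V, hV, he⟩ := Int.csInf_mem hne hbdd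
  refine ⟨V, hV, fun v hv => le_antisymm ?_ (csInf_le hbdd ⟨v, hV.trans hv, rfl⟩)⟩
  exact (q.at_anti_right hV hv).trans_eq he

theorem monotone_limTop : Monotone q.limTop := fun u u' h => by
  obtain ⟨V, hV, h1⟩ := q.exists_forall_at_eq_limTop u
  obtain ⟨V', hV', h2⟩ := q.exists_forall_at_eq_limTop u'
  rw [← h1 (max V V') (le_max_left _ _), ← h2 (max V V') (le_max_right _ _)]
  exact q.at_mono_left h (hV'.trans (le_max_right _ _))

/-- Shrinking `ε` or raising `v` can only lower the difference, so the minimum persists for small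
`ε` and large `v`, where it is the jump of the limit. -/
theorem infiniteMult_eq_jumpAt (a : ℝ) : (q.infiniteMult a : ℤ) = jumpAt q.limTop a := by
  set S := {n : ℕ | ∃ ε v : ℝ, 0 < ε ∧ a + ε < v ∧ (n : ℤ) = q.at (a + ε) v - q.at (a - ε) v}
    with hS
  have hmem : ∀ ε v, 0 < ε → a + ε < v → (q.at (a + ε) v - q.at (a - ε) v).toNat ∈ S :=
    fun ε v h h' => ⟨ε, v, h, h', Int.toNat_of_nonneg
      (sub_nonneg.2 (q.at_mono_left (by linarith) h'.le))⟩
  obtain ⟨ε, v, hε, hv, he⟩ : q.infiniteMult a ∈ S :=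
    Nat.sInf_mem ⟨_, hmem 1 (a + 2) one_pos (by linarith)⟩
  obtain ⟨δ, hδ, h⟩ := q.monotone_limTop.exists_forall_sub_eq_jumpAt a
  obtain ⟨s, hs, hs'⟩ := exists_between (lt_min hε hδ)
  simp only [lt_min_iff] at hs'
  obtain ⟨V₁, -, h₁⟩ := q.exists_forall_at_eq_limTop (a + s)
  obtain ⟨V₂, -, h₂⟩ := q.exists_forall_at_eq_limTop (a - s)
  set V := max v (max V₁ V₂) with hV
  have hvV : v ≤ V := le_max_left _ _
  rw [← h s hs hs'.2, ← h₁ V ((le_max_left _ _).trans (le_max_right _ _)),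
    ← h₂ V ((le_max_right _ _).trans (le_max_right _ _))]
  refine le_antisymm ?_ ?_
  · have h3 : q.infiniteMult a ≤ _ := Nat.sInf_le (hmem s V hs (by linarith))
    have h4 : q.at (a - s) V ≤ q.at (a + s) V := q.at_mono_left (by linarith) (by linarith)
    omega
  · rw [he]
    have h3 := q.at_sub_le (show a - ε ≤ a + ε by linarith) hv.le hvV
    have h4 : q.at (a + s) V ≤ q.at (a + ε) V := q.at_mono_left (by linarith) (by linarith)
    have h5 : q.at (a - ε) V ≤ q.at (a - s) V := q.at_mono_left (by linarith) (by linarith)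
    linarith

/-- Two persistence functions are `η`-interleaved. -/
def Interleaved (q q' : CategoricalPersistenceFunction ℝ) (η : ℝ) : Prop :=
  ∀ u v, u < v → q.at (u - η) (v + η) ≤ q'.at u v ∧ q'.at (u - η) (v + η) ≤ q.at u v

/-! ### Multiplicities under small interleavings -/

variable {q} in
theorem Interleaved.limTop_le {q' : CategoricalPersistenceFunction ℝ} {η : ℝ}
    (h : Interleaved q q' η) (u : ℝ) :
    q.limTop (u - η) ≤ q'.limTop u ∧ q'.limTop (u - η) ≤ q.limTop u := by
  obtain ⟨V₁, -, h₁⟩ := q.exists_forall_at_eq_limTop (u - η)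
  obtain ⟨V₂, -, h₂⟩ := q'.exists_forall_at_eq_limTop (u - η)
  obtain ⟨V₃, -, h₃⟩ := q.exists_forall_at_eq_limTop u
  obtain ⟨V₄, -, h₄⟩ := q'.exists_forall_at_eq_limTop u
  obtain ⟨V, hV⟩ : ∃ V, u < V ∧ V₁ - η ≤ V ∧ V₂ - η ≤ V ∧ V₃ ≤ V ∧ V₄ ≤ V := by
    refine ⟨max (u + 1) (max (max (V₁ - η) (V₂ - η)) (max V₃ V₄)), ?_, ?_, ?_, ?_, ?_⟩
    · exact lt_of_lt_of_le (lt_add_one u) (le_max_left _ _)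
    all_goals simp
  rw [← h₁ (V + η) (by linarith), ← h₂ (V + η) (by linarith), ← h₃ V (by linarith),
    ← h₄ V (by linarith)]
  exact h u V hV.1

/-- Each corner value of `q'` is squeezed between two values of `q` at points shifted by `η`. As `η
< σ` and `σ + η < s₀`, both stay in the same quadrant near `(a, b)`, where `q` is constant. -/
theorem exists_boxSum_eq_properMult {a b : ℝ} (hab : a < b) :
    ∃ s₀ > 0, a + s₀ < b - s₀ ∧ ∀ (q' : CategoricalPersistenceFunction ℝ) (η : ℝ), 0 < η →
      Interleaved q q' η → ∀ σ, η < σ → σ + η < s₀ →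
        boxSum q'.at (a - σ) (a + σ) (b - σ) (b + σ) = q.properMult a b := by
  have hF := q.rankLike_clamp ((a + b) / 2)
  obtain ⟨δ, hδ, c₁, c₂, c₃, c₄, hc⟩ := hF.exists_quadrants a b
  obtain ⟨δ', hδ', hm⟩ := q.hasCornerMult_clamp (a := a) (b := b) (w := (a + b) / 2)
    (by linarith) (by linarith)
  have hn : (q.properMult a b : ℤ) = c₁ - c₂ - c₃ + c₄ := by
    obtain ⟨s, hs, hs'⟩ := exists_between (lt_min hδ hδ')
    simp only [lt_min_iff] at hs'
    rw [← hm s hs hs'.2, boxSum]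
    obtain ⟨e1, e2, e3, e4⟩ := hc s s hs hs'.1 hs hs'.1
    rw [e1, e2, e3, e4]
  refine ⟨min δ ((b - a) / 4), lt_min hδ (by linarith), ?_, fun q' η hη hq σ hσ hσ' => ?_⟩
  · linarith [min_le_right δ ((b - a) / 4)]
  rw [lt_min_iff] at hσ'
  have hcl : ∀ u v, u ≤ (a + b) / 2 → (a + b) / 2 ≤ v → q.at u v = q.clamp ((a + b) / 2) u v :=
    fun u v hu hv => (q.clamp_of_le hu hv).symm
  have e₁ := hc (σ - η) (σ - η) (by linarith) (by linarith) (by linarith) (by linarith)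
  have e₂ := hc (σ - η) (σ + η) (by linarith) (by linarith) (by linarith) (by linarith)
  have e₃ := hc (σ + η) (σ - η) (by linarith) (by linarith) (by linarith) (by linarith)
  have e₄ := hc (σ + η) (σ + η) (by linarith) (by linarith) (by linarith) (by linarith)
  have key : ∀ u v c, u + η < (a + b) / 2 → (a + b) / 2 < v - η →
      q.clamp ((a + b) / 2) (u - η) (v + η) = c → q.clamp ((a + b) / 2) (u + η) (v - η) = c →
      q'.at u v = c := by
    intro u v c hu hv h1 h2
    refine le_antisymm ?_ ?_
    · have := (hq (u + η) (v - η) (by linarith)).2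
      rw [hcl _ _ hu.le hv.le, h2] at this
      simpa using this
    · have := (hq u v (by linarith)).1
      rwa [hcl _ _ (by linarith) (by linarith), h1] at this
  have k1 : q'.at (a + σ) (b - σ) = c₁ := key _ _ _ (by linarith) (by linarith)
    (by rw [← e₁.1]; congr 1 <;> ring) (by rw [← e₄.1]; congr 1 <;> ring)
  have k2 : q'.at (a - σ) (b - σ) = c₂ := key _ _ _ (by linarith) (by linarith)
    (by rw [← e₃.2.1]; congr 1 <;> ring) (by rw [← e₂.2.1]; congr 1 <;> ring)
  have k3 : q'.at (a + σ) (b + σ) = c₃ := key _ _ _ (by linarith) (by linarith)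
    (by rw [← e₂.2.2.1]; congr 1 <;> ring) (by rw [← e₃.2.2.1]; congr 1 <;> ring)
  have k4 : q'.at (a - σ) (b + σ) = c₄ := key _ _ _ (by linarith) (by linarith)
    (by rw [← e₄.2.2.2]; congr 1 <;> ring) (by rw [← e₁.2.2.2]; congr 1 <;> ring)
  rw [hn, boxSum, k1, k2, k3, k4]

theorem exists_limTop_sub_eq_infiniteMult (a : ℝ) :
    ∃ s₀ > 0, ∀ (q' : CategoricalPersistenceFunction ℝ) (η : ℝ), 0 < η →
      Interleaved q q' η → ∀ σ, η < σ → σ + η < s₀ →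
        q'.limTop (a + σ) - q'.limTop (a - σ) = q.infiniteMult a := by
  obtain ⟨δ, hδ, h⟩ := q.monotone_limTop.exists_forall_eq_lim a
  refine ⟨δ, hδ, fun q' η hη hq σ hσ hσ' => ?_⟩
  have e₁ := h (σ - η) (by linarith) (by linarith)
  have e₂ := h (σ + η) (by linarith) hσ'
  have key : ∀ u c, q.limTop (u - η) = c → q.limTop (u + η) = c → q'.limTop u = c := by
    intro u c h1 h2
    refine le_antisymm ?_ ?_
    · have := (Interleaved.limTop_le hq (u + η)).2
      rw [h2] at this
      simpa using this
    · have := (Interleaved.limTop_le hq u).1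
      rwa [h1] at this
  rw [q.infiniteMult_eq_jumpAt, jumpAt,
    key (a + σ) (Function.rightLim q.limTop a) (by rw [← e₁.1]; congr 1; ring) (by rw [← e₂.1]; congr 1; ring),
    key (a - σ) (Function.leftLim q.limTop a) (by rw [← e₂.2]; congr 1; ring) (by rw [← e₁.2]; congr 1; ring)]

theorem sum_properMult_le {u₁ u₂ v₁ v₂ : ℝ} (h₁ : u₁ ≤ u₂) (h₂ : u₂ ≤ v₁) (h₃ : v₁ ≤ v₂)
    (T : Finset (ℝ × ℝ)) (hT : ∀ x ∈ T, u₁ < x.1 ∧ x.1 < u₂ ∧ v₁ < x.2 ∧ x.2 < v₂) :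
    ((∑ x ∈ T, q.properMult x.1 x.2 : ℕ) : ℤ) ≤ boxSum q.at u₁ u₂ v₁ v₂ := by
  rw [← q.boxSum_clamp h₁ le_rfl h₂ h₃]
  exact (q.rankLike_clamp u₂).sum_le_boxSum (m := fun x => q.properMult x.1 x.2) h₁ h₃
    (fun x _ hx hx' _ => q.hasCornerMult_clamp hx (h₂.trans_lt hx')) T hT

theorem exists_boxSum_le_sum_properMult {u₁ u₂ v₁ v₂ : ℝ} (h₁ : u₁ ≤ u₂) (h₂ : u₂ < v₁)
    (h₃ : v₁ ≤ v₂) :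
    ∃ T : Finset (ℝ × ℝ), (∀ x ∈ T, u₁ ≤ x.1 ∧ x.1 ≤ u₂ ∧ v₁ ≤ x.2 ∧ x.2 ≤ v₂) ∧
      boxSum q.at u₁ u₂ v₁ v₂ ≤ ((∑ x ∈ T, q.properMult x.1 x.2 : ℕ) : ℤ) := by
  rw [← q.boxSum_clamp (w := (u₂ + v₁) / 2) h₁ (by linarith) (by linarith) h₃]
  exact (q.rankLike_clamp _).exists_boxSum_le_sum (m := fun x => q.properMult x.1 x.2) h₁ h₃
    fun x _ hx hx' _ => q.hasCornerMult_clamp (by linarith) (by linarith)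

/-- Only finitely many corners lie above and to the left of a point of the diagonal. -/
theorem finite_properMult_ne_zero (w : ℝ) :
    {x : ℝ × ℝ | x.1 < w ∧ w < x.2 ∧ q.properMult x.1 x.2 ≠ 0}.Finite := by
  classical
  obtain ⟨m, hm⟩ := q.lowerBounded
  by_contra hinf
  -- Whatever its size `r`, the box with lower right corner `(w, w)` has box sum at most `q.at w w -
  -- m`.
  obtain ⟨T, hT, hcard⟩ := Set.Infinite.exists_subset_card_eq hinf ((q.at w w - m).toNat + 1)
  obtain ⟨r, hr, hTr⟩ : ∃ r, 0 < r ∧ ∀ x ∈ T, w - r < x.1 ∧ x.2 < w + r := by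
    obtain ⟨M, hM⟩ := (T.finite_toSet.image fun x => max (w - x.1) (x.2 - w)).bddAbove
    refine ⟨max M 0 + 1, by positivity, fun x hx => ?_⟩
    have h1 := (hM (Set.mem_image_of_mem _ hx)).trans (le_max_left M 0)
    simp only [max_le_iff] at h1
    constructor <;> linarith
  have h1 := q.sum_properMult_le (u₁ := w - r) (u₂ := w) (v₁ := w) (v₂ := w + r) (by linarith)
    le_rfl (by linarith) T fun x hx => ⟨(hTr x hx).1, (hT hx).1, (hT hx).2.1, (hTr x hx).2⟩
  have h2 : T.card ≤ ∑ x ∈ T, q.properMult x.1 x.2 := by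
    rw [Finset.card_eq_sum_ones]
    exact Finset.sum_le_sum fun x hx => Nat.one_le_iff_ne_zero.2 (hT hx).2.2
  have h3 : q.at (w - r) (w + r) ≤ q.at (w - r) w := q.at_anti_right (by linarith) (by linarith)
  have h4 : m ≤ q.at w (w + r) := by
    rw [q.at_of_le (by linarith)]
    exact hm _
  simp only [boxSum] at h1
  omega

/-! ### Paths of persistence functions -/

theorem boundedMotion_properMult {q : ℝ → CategoricalPersistenceFunction ℝ} {k h : ℝ}
    (hk : 0 < k) (hkh : k < h)
    (hq : ∀ s t, 0 ≤ s → s ≤ 1 → 0 ≤ t → t ≤ 1 → ∀ η, 0 < η → |s - t| * k ≤ η →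
      Interleaved (q t) (q s) η) :
    BoundedMotion (fun t (x : ℝ × ℝ) => (q t).properMult x.1 x.2) {x | x.1 < x.2} h where
  upper t ht ht' p hp := by
    obtain ⟨s₀, hs₀, hlt, hbox⟩ := (q t).exists_boxSum_eq_properMult hp
    -- This makes `η = s₀ / 4` an interleaving and keeps `T` inside the open box of radius `σ = s₀ /
    -- 2`, with `η < σ` and `σ + η < s₀`.
    refine ⟨min (s₀ / 4) (s₀ / (4 * k)), by positivity, fun s hs hs' hst T hT => ?_⟩
    simp only [lt_min_iff] at hst hT
    have h1 := (lt_div_iff₀ (by positivity)).1 hst.2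
    have h2 := hbox (q s) (s₀ / 4) (by linarith)
      (hq s t hs hs' ht ht' _ (by linarith) (by linarith)) (s₀ / 2) (by linarith) (by linarith)
    have h3 := (q s).sum_properMult_le (u₁ := p.1 - s₀ / 2) (u₂ := p.1 + s₀ / 2)
      (v₁ := p.2 - s₀ / 2) (v₂ := p.2 + s₀ / 2) (by linarith) (by linarith) (by linarith) T
      fun y hy => by
        have := (hT y hy).1
        rw [Prod.dist_eq, max_lt_iff, Real.dist_eq, Real.dist_eq, abs_lt, abs_lt] at this
        refine ⟨?_, ?_, ?_, ?_⟩ <;> linarith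
    rw [h2] at h3
    exact_mod_cast h3
  lower t ht ht' p hp := by
    obtain ⟨s₀, hs₀, hlt, hbox⟩ := (q t).exists_boxSum_eq_properMult hp
    have hh : 0 < h := hk.trans hkh
    -- Here `η = (s - t) * k` and `σ = (s - t) * h`: the strict inequality `k < h` gives `η < σ`,
    -- and `σ + η < 2 * (s - t) * h < s₀`.
    refine ⟨s₀ / (2 * h), by positivity, fun s hts hs1 hst => ?_⟩
    have h1 := (lt_div_iff₀ (by positivity)).1 hst
    have hpos : 0 < s - t := sub_pos.2 hts
    have hlt' : (s - t) * k < (s - t) * h := mul_lt_mul_of_pos_left hkh hpos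
    have h2 := hbox (q s) ((s - t) * k) (by positivity)
      (hq s t (by linarith) hs1 ht ht'.le _ (by positivity) (by rw [abs_of_pos hpos]))
      ((s - t) * h) hlt' (by linarith)
    have hσ : 0 < (s - t) * h := by positivity
    obtain ⟨T, hT, hsum⟩ := (q s).exists_boxSum_le_sum_properMult
      (u₁ := p.1 - (s - t) * h) (u₂ := p.1 + (s - t) * h) (v₁ := p.2 - (s - t) * h)
      (v₂ := p.2 + (s - t) * h) (by linarith) (by linarith) (by linarith)
    refine ⟨T, fun y hy => ?_, ?_⟩
    · have := hT y hy
      rw [Prod.dist_eq, max_le_iff, Real.dist_eq, Real.dist_eq, abs_le, abs_le]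
      refine ⟨⟨?_, ?_⟩, ?_, ?_⟩ <;> linarith
    · rw [h2] at hsum
      exact_mod_cast hsum

theorem boundedMotion_infiniteMult {q : ℝ → CategoricalPersistenceFunction ℝ} {k h : ℝ}
    (hk : 0 < k) (hkh : k < h)
    (hq : ∀ s t, 0 ≤ s → s ≤ 1 → 0 ≤ t → t ≤ 1 → ∀ η, 0 < η → |s - t| * k ≤ η →
      Interleaved (q t) (q s) η) :
    BoundedMotion (fun t a => (q t).infiniteMult a) Set.univ h where
  upper t ht ht' p _ := by
    obtain ⟨s₀, hs₀, hjump⟩ := (q t).exists_limTop_sub_eq_infiniteMult p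
    refine ⟨min (s₀ / 4) (s₀ / (4 * k)), by positivity, fun s hs hs' hst T hT => ?_⟩
    simp only [lt_min_iff] at hst hT
    have h1 := (lt_div_iff₀ (by positivity)).1 hst.2
    have h2 := hjump (q s) (s₀ / 4) (by linarith)
      (hq s t hs hs' ht ht' _ (by linarith) (by linarith)) (s₀ / 2) (by linarith) (by linarith)
    have h3 := (q s).monotone_limTop.sum_jumpAt_le (p - s₀ / 2) T (p + s₀ / 2) (by linarith)
      fun y hy => by
        have := (hT y hy).1
        rw [Real.dist_eq, abs_lt] at this
        constructor <;> linarith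
    simp only [h2, ← infiniteMult_eq_jumpAt] at h3
    exact_mod_cast h3
  lower t ht ht' p _ := by
    obtain ⟨s₀, hs₀, hjump⟩ := (q t).exists_limTop_sub_eq_infiniteMult p
    have hh : 0 < h := hk.trans hkh
    refine ⟨s₀ / (2 * h), by positivity, fun s hts hs1 hst => ?_⟩
    have h1 := (lt_div_iff₀ (by positivity)).1 hst
    have hpos : 0 < s - t := sub_pos.2 hts
    have hlt' : (s - t) * k < (s - t) * h := mul_lt_mul_of_pos_left hkh hpos
    have h2 := hjump (q s) ((s - t) * k) (by positivity)
      (hq s t (by linarith) hs1 ht ht'.le _ (by positivity) (by rw [abs_of_pos hpos]))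
      ((s - t) * h) hlt' (by linarith)
    have hσ : 0 < (s - t) * h := by positivity
    obtain ⟨T, hT, hsum⟩ := (q s).monotone_limTop.exists_sub_le_sum_jumpAt
      (α := p - (s - t) * h) (β := p + (s - t) * h) (by linarith)
    refine ⟨T, fun y hy => ?_, ?_⟩
    · have := hT y hy
      rw [Real.dist_eq, abs_le]
      constructor <;> linarith
    · simp only [h2, ← infiniteMult_eq_jumpAt] at hsum
      exact_mod_cast hsum

end CategoricalPersistenceFunction

/-! ### Matchings of persistence diagrams -/

namespace CategoricalPersistenceFunction

variable (q : CategoricalPersistenceFunction ℝ)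

theorem diagram_mult_top (a : ℝ) : q.diagram.mult (a, ⊤) = (q.infiniteMult a : ℕ∞) := rfl

theorem diagram_mult_of_ne {a b : ℝ} (h : a ≠ b) :
    q.diagram.mult (a, (b : WithTop ℝ)) = (q.properMult a b : ℕ∞) := if_neg h

theorem lt_of_fin_properMult {x : ℝ × ℝ} (i : Fin (q.properMult x.1 x.2)) : x.1 < x.2 :=
  q.lt_of_properMult_ne_zero (Nat.ne_of_gt i.pos)

/-- The points at infinity of the diagram. -/
def infiniteElement (z : Σ a, Fin (q.infiniteMult a)) : q.diagram.Element :=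
  ⟨(z.1, ⊤), z.2, by rw [q.diagram_mult_top]; exact_mod_cast z.2.2⟩

/-- The proper points of the diagram off the diagonal. -/
def properElement (z : Σ x : ℝ × ℝ, Fin (q.properMult x.1 x.2)) : q.diagram.Element :=
  ⟨(z.1.1, (z.1.2 : WithTop ℝ)), z.2, by
    rw [q.diagram_mult_of_ne (q.lt_of_fin_properMult z.2).ne]; exact_mod_cast z.2.2⟩

/-- The points on the diagonal. -/
def diagonalElement (w : ℝ) (n : ℕ) : q.diagram.Element :=
  ⟨(w, (w : WithTop ℝ)), n, by rw [q.diagram.diagonal]; exact ENat.natCast_lt_top n⟩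

theorem infiniteElement_injective : Function.Injective q.infiniteElement := by
  rintro ⟨a, i, hi⟩ ⟨b, j, hj⟩ h
  cases h
  rfl

theorem properElement_injective : Function.Injective q.properElement := by
  rintro ⟨⟨a, b⟩, i, hi⟩ ⟨⟨c, d⟩, j, hj⟩ h
  cases h
  rfl

theorem diagonalElement_inj {w w' : ℝ} {n n' : ℕ}
    (h : q.diagonalElement w n = q.diagonalElement w' n') : w = w' ∧ n = n' := by
  cases h
  exact ⟨rfl, rfl⟩

theorem infiniteElement_ne_properElement (z z') : q.infiniteElement z ≠ q.properElement z' :=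
  fun h => WithTop.top_ne_coe (congrArg (fun e : q.diagram.Element => e.1.2) h)

theorem infiniteElement_ne_diagonalElement (z w n) :
    q.infiniteElement z ≠ q.diagonalElement w n :=
  fun h => WithTop.top_ne_coe (congrArg (fun e : q.diagram.Element => e.1.2) h)

theorem properElement_ne_diagonalElement (z w n) :
    q.properElement z ≠ q.diagonalElement w n := fun h => by
  have h1 : z.1.1 = w := congrArg (fun e : q.diagram.Element => e.1.1) h
  have h2 : (z.1.2 : WithTop ℝ) = w := congrArg (fun e : q.diagram.Element => e.1.2) h
  rw [WithTop.coe_inj] at h2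
  exact (q.lt_of_fin_properMult z.2).ne (h1.trans h2.symm)

theorem element_cases (e : q.diagram.Element) :
    (∃ z, e = q.infiniteElement z) ∨ (∃ z, e = q.properElement z) ∨
      ∃ w n, e = q.diagonalElement w n := by
  obtain ⟨⟨a, b⟩, i, hi⟩ := e
  induction b using WithTop.recTopCoe with
  | top =>
    have hi' := hi
    rw [q.diagram_mult_top] at hi'
    exact Or.inl ⟨⟨a, i, by exact_mod_cast hi'⟩, rfl⟩
  | coe b =>
    by_cases hab : a = b
    · subst hab
      exact Or.inr (Or.inr ⟨a, i, rfl⟩)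
    · have hi' := hi
      rw [q.diagram_mult_of_ne hab] at hi'
      exact Or.inr (Or.inl ⟨⟨(a, b), i, by exact_mod_cast hi'⟩, rfl⟩)

/-- The proper elements of the diagram whose nearest point on the diagonal is `(w, w)`. -/
def fiberOver (w : ℝ) : Set q.diagram.Element :=
  Set.range (q.diagonalElement w) ∪ q.properElement '' {z | z.1.1 + z.1.2 = 2 * w}

/-- An off-diagonal point with midpoint `w` lies strictly above and to the left of `(w, w)`, and
only finitely many do. -/
theorem countable_fiberOver (w : ℝ) : (q.fiberOver w).Countable := by
  refine (Set.countable_range _).union (Set.Countable.image ?_ _)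
  refine Set.Countable.mono (fun z hz => ?_)
    (Set.Countable.biUnion (q.finite_properMult_ne_zero w).countable
      (t := fun x _ => Set.range (Sigma.mk x)) fun x _ => Set.countable_range _)
  have h1 := q.lt_of_fin_properMult z.2
  have h2 : z.1.1 + z.1.2 = 2 * w := hz
  exact Set.mem_iUnion₂.2
    ⟨z.1, ⟨by linarith, by linarith, Nat.ne_of_gt z.2.pos⟩, z.2, rfl⟩

end CategoricalPersistenceFunction

theorem pointDist_coe_le {x y : ℝ × ℝ} {h : ℝ} (hd : dist y x ≤ h) :
    pointDist (x.1, (x.2 : WithTop ℝ)) (y.1, (y.2 : WithTop ℝ)) ≤ ENNReal.ofReal h := by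
  rw [dist_comm, Prod.dist_eq, max_le_iff] at hd
  exact max_le (ENNReal.ofReal_le_ofReal hd.1) (ENNReal.ofReal_le_ofReal hd.2)

theorem pointDist_top_le {a b : ℝ} {h : ℝ} (hd : dist b a ≤ h) :
    pointDist (a, ⊤) (b, ⊤) ≤ ENNReal.ofReal h := by
  rw [dist_comm] at hd
  exact max_le (ENNReal.ofReal_le_ofReal hd) zero_le

theorem ordinateDist_comm (a b : WithTop ℝ) : ordinateDist a b = ordinateDist b a := by
  induction a using WithTop.recTopCoe with
  | top => induction b using WithTop.recTopCoe <;> rfl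
  | coe a =>
    induction b using WithTop.recTopCoe with
    | top => rfl
    | coe b => exact congrArg ENNReal.ofReal (abs_sub_comm a b)

theorem pointDist_comm (x y : ℝ × WithTop ℝ) : pointDist x y = pointDist y x := by
  rw [pointDist, pointDist, abs_sub_comm, ordinateDist_comm]

namespace CategoricalPersistenceFunction

/-- Points at infinity and points far from the diagonal follow the Hall matchings; the rest go to
their diagonal projections. Naming the end points `q₀`, `q₁` lets the lemma be applied to a reversed
path. -/
theorem exists_injective_element {q : ℝ → CategoricalPersistenceFunction ℝ} {k h : ℝ}
    (hk : 0 < k) (hkh : k < h)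
    (hq : ∀ s t, 0 ≤ s → s ≤ 1 → 0 ≤ t → t ≤ 1 → ∀ η, 0 < η → |s - t| * k ≤ η →
      Interleaved (q t) (q s) η)
    {q₀ q₁ : CategoricalPersistenceFunction ℝ} (h₀ : q 0 = q₀) (h₁ : q 1 = q₁) :
    ∃ f : q₀.diagram.Element → q₁.diagram.Element, Function.Injective f ∧
      ∀ e, pointDist e.1 (f e).1 ≤ ENNReal.ofReal h := by
  subst h₀ h₁
  have hh : 0 < h := hk.trans hkh
  obtain ⟨φ, hφ, hφd⟩ : ∃ φ : {e : Σ x : ℝ × ℝ, Fin ((q 0).properMult x.1 x.2) //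
      Metric.closedBall e.1 h ⊆ {x | x.1 < x.2}} → Σ x : ℝ × ℝ, Fin ((q 1).properMult x.1 x.2),
      Function.Injective φ ∧ ∀ e, dist (φ e).1 e.1.1 ≤ h :=
    (boundedMotion_properMult hk hkh hq).exists_injective hh
  obtain ⟨ψ, hψ, hψd⟩ : ∃ ψ : {e : Σ a : ℝ, Fin ((q 0).infiniteMult a) //
      Metric.closedBall e.1 h ⊆ Set.univ} → Σ a : ℝ, Fin ((q 1).infiniteMult a),
      Function.Injective ψ ∧ ∀ e, dist (ψ e).1 e.1.1 ≤ h :=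
    (boundedMotion_infiniteMult hk hkh hq).exists_injective hh
  -- `N w` assigns distinct copies of `(w, w)` to all elements projecting there, the diagonal ones
  -- included.
  choose N hN using fun w => Set.countable_iff_exists_injOn.1 ((q 0).countable_fiberOver w)
  have key : ∀ e : (q 0).diagram.Element, ∃ y : (q 1).diagram.Element,
      pointDist e.1 y.1 ≤ ENNReal.ofReal h ∧
      ((∃ z, e = (q 0).infiniteElement z.1 ∧ y = (q 1).infiniteElement (ψ z)) ∨
        (∃ z, e = (q 0).properElement z.1 ∧ y = (q 1).properElement (φ z)) ∨
        ∃ w, e ∈ (q 0).fiberOver w ∧ y = (q 1).diagonalElement w (N w e)) := by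
    intro e
    rcases (q 0).element_cases e with ⟨z, rfl⟩ | ⟨z, rfl⟩ | ⟨w, n, rfl⟩
    · exact ⟨(q 1).infiniteElement (ψ ⟨z, Set.subset_univ _⟩), pointDist_top_le (hψd _),
        Or.inl ⟨_, rfl, rfl⟩⟩
    · by_cases hz : Metric.closedBall z.1 h ⊆ {x | x.1 < x.2}
      · exact ⟨(q 1).properElement (φ ⟨z, hz⟩), pointDist_coe_le (hφd ⟨z, hz⟩),
          Or.inr (Or.inl ⟨_, rfl, rfl⟩)⟩
      · refine ⟨_, ?_, Or.inr (Or.inr ⟨(z.1.1 + z.1.2) / 2, Or.inr ⟨z, ?_, rfl⟩, rfl⟩)⟩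
        · have h1 := (q 0).lt_of_fin_properMult z.2
          -- The sup-norm distance to the diagonal is half the height; were it more than `h`, the
          -- closed ball would stay above the diagonal.
          have h2 : z.1.2 - z.1.1 ≤ 2 * h := by
            by_contra hcon
            refine hz fun x hx => ?_
            rw [Metric.mem_closedBall, Prod.dist_eq, max_le_iff, Real.dist_eq, Real.dist_eq,
              abs_le, abs_le] at hx
            show x.1 < x.2
            linarith
          refine pointDist_coe_le (x := z.1) (y := ((z.1.1 + z.1.2) / 2, (z.1.1 + z.1.2) / 2)) ?_
          rw [Prod.dist_eq, max_le_iff, Real.dist_eq, Real.dist_eq, abs_le, abs_le]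
          refine ⟨⟨?_, ?_⟩, ?_, ?_⟩ <;> simp only <;> linarith
        · show z.1.1 + z.1.2 = 2 * ((z.1.1 + z.1.2) / 2)
          ring
    · refine ⟨_, ?_, Or.inr (Or.inr ⟨w, Or.inl ⟨n, rfl⟩, rfl⟩)⟩
      exact pointDist_coe_le (x := (w, w)) (y := (w, w)) (by simpa using hh.le)
  choose f hfd hf using key
  refine ⟨f, fun e e' he => ?_, hfd⟩
  rcases hf e with ⟨z, h1, h2⟩ | ⟨z, h1, h2⟩ | ⟨w, h1, h2⟩ <;>
    rcases hf e' with ⟨z', h1', h2'⟩ | ⟨z', h1', h2'⟩ | ⟨w', h1', h2'⟩ <;>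
    rw [h2, h2'] at he
  · rw [h1, h1', hψ ((q 1).infiniteElement_injective he)]
  · exact absurd he ((q 1).infiniteElement_ne_properElement _ _)
  · exact absurd he ((q 1).infiniteElement_ne_diagonalElement _ _ _)
  · exact absurd he.symm ((q 1).infiniteElement_ne_properElement _ _)
  · rw [h1, h1', hφ ((q 1).properElement_injective he)]
  · exact absurd he ((q 1).properElement_ne_diagonalElement _ _ _)
  · exact absurd he.symm ((q 1).infiniteElement_ne_diagonalElement _ _ _)
  · exact absurd he.symm ((q 1).properElement_ne_diagonalElement _ _ _)
  · obtain ⟨rfl, hn⟩ := (q 1).diagonalElement_inj he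
    exact hN w h1 h1' hn

/-- Persistence functions joined by a path of speed at most `k` have bottleneck distance at most
`h`, for every `h > k`. -/
theorem bottleneckDist_le_of_path {q : ℝ → CategoricalPersistenceFunction ℝ} {k h : ℝ}
    (hk : 0 < k) (hkh : k < h)
    (hq : ∀ s t, 0 ≤ s → s ≤ 1 → 0 ≤ t → t ≤ 1 → ∀ η, 0 < η → |s - t| * k ≤ η →
      Interleaved (q t) (q s) η) :
    bottleneckDist (q 0).diagram (q 1).diagram ≤ ENNReal.ofReal h := by
  obtain ⟨f, hf, hfd⟩ := exists_injective_element hk hkh hq rfl rfl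
  obtain ⟨g, hg, hgd⟩ := exists_injective_element (q := fun t => q (1 - t)) hk hkh
    (fun s t hs hs' ht ht' η hη hle => hq (1 - s) (1 - t) (by linarith) (by linarith) (by linarith)
      (by linarith) η hη (by rwa [sub_sub_sub_cancel_left, abs_sub_comm])) (q₀ := q 1) (q₁ := q 0)
    (by simp) (by simp)
  -- The bijection uses only pairs matched by `f` or by `g`, so it inherits their displacement
  -- bound.
  obtain ⟨γ, hγ, hγd⟩ := Function.Embedding.schroeder_bernstein_of_rel hf hg
    (fun x y => pointDist x.1 y.1 ≤ ENNReal.ofReal h) hfd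
    fun y => (pointDist_comm _ _).trans_le (hgd y)
  exact (iInf_le _ (Equiv.ofBijective γ hγ)).trans (iSup_le hγd)

end CategoricalPersistenceFunction

/-! ### Interpolation of weights -/

namespace WeightedGraph

theorem weightDiff_symm_le (W W' : WeightedGraph.{w}) (ψ : W.graph ≃g W'.graph) :
    weightDiff W' W ψ.symm ≤ weightDiff W W' ψ := by
  refine iSup_le fun e => ?_
  have h : ψ.mapEdgeSet (ψ.symm.mapEdgeSet e) = e := ψ.mapEdgeSet.apply_symm_apply e
  refine le_trans (le_of_eq ?_)
    (le_iSup (fun e => ENNReal.ofReal |W.weight e - W'.weight (ψ.mapEdgeSet e)|)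
      (ψ.symm.mapEdgeSet e))
  rw [h, abs_sub_comm]

theorem mapEdgeSet_trans {W V V' : WeightedGraph.{w}} (χ : W.graph ≃g V.graph)
    (χ' : W.graph ≃g V'.graph) (e : W.graph.edgeSet) :
    (show V.graph ≃g V'.graph from χ.symm.trans χ').mapEdgeSet (χ.mapEdgeSet e) = χ'.mapEdgeSet e := by
  obtain ⟨e, he⟩ := e
  induction e using Sym2.ind with
  | _ x y => exact Subtype.ext (by simp [SimpleGraph.Iso.mapEdgeSet, SimpleGraph.Hom.mapEdgeSet])

theorem weightDiff_symm_trans_le {W V V' : WeightedGraph.{w}} (χ : W.graph ≃g V.graph)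
    (χ' : W.graph ≃g V'.graph) {η : ℝ}
    (h : ∀ e, |V.weight (χ.mapEdgeSet e) - V'.weight (χ'.mapEdgeSet e)| ≤ η) :
    weightDiff V V' (χ.symm.trans χ') ≤ ENNReal.ofReal η := by
  refine iSup_le fun e => ENNReal.ofReal_le_ofReal ?_
  obtain ⟨e, rfl⟩ := χ.mapEdgeSet.surjective e
  rw [mapEdgeSet_trans]
  exact h e

/-- Interpolating between the weights of isomorphic weighted graphs. -/
theorem exists_interpolation (W W' : WeightedGraph.{w}) (ψ : W.graph ≃g W'.graph) (t : ℝ) :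
    ∃ (V : WeightedGraph.{w}) (χ : W.graph ≃g V.graph),
      (∀ e, V.weight (χ.mapEdgeSet e) =
        (1 - t) * W.weight e + t * W'.weight (ψ.mapEdgeSet e)) ∧
      (t = 0 → V = W) ∧ (t = 1 → V = W') := by
  have hrefl : ∀ e, (SimpleGraph.Iso.refl (G := W.graph)).mapEdgeSet e = e := fun ⟨e, he⟩ => by
    induction e using Sym2.ind with
    | _ x y => rfl
  -- The end points are treated apart so that the path ends at `W` and `W'` themselves, although
  -- their vertex types differ.
  by_cases h0 : t = 0
  · refine ⟨W, SimpleGraph.Iso.refl, fun e => ?_, fun _ => rfl, fun h1 => by linarith⟩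
    rw [hrefl, h0]; ring
  by_cases h1 : t = 1
  · refine ⟨W', ψ, fun e => ?_, fun h => absurd h h0, fun _ => rfl⟩
    rw [h1]; ring
  · refine ⟨⟨W.toFinGraph, fun e => (1 - t) * W.weight e + t * W'.weight (ψ.mapEdgeSet e)⟩,
      SimpleGraph.Iso.refl, fun e => ?_, fun h => absurd h h0, fun h => absurd h h1⟩
    simp only
    rw [hrefl]

end WeightedGraph

/-! ### Balanced generators and the stability bound -/

theorem IpFunctionGenerator.Balanced.interleaved {p : IpFunctionGenerator FinGraph.{w}}
    (hp : p.Balanced) {W W' : WeightedGraph.{w}} (ψ : W.graph ≃g W'.graph) {η : ℝ} (hη : 0 < η)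
    (h : WeightedGraph.weightDiff W W' ψ ≤ ENNReal.ofReal η) :
    (p.ofWeighted W).Interleaved (p.ofWeighted W') η := fun u v huv =>
  ⟨hp W W' ψ η hη h u v huv,
    hp W' W ψ.symm η hη ((WeightedGraph.weightDiff_symm_le W W' ψ).trans h) u v huv⟩

theorem theorem1 (p : IpFunctionGenerator FinGraph.{w}) (hp : p.Balanced)
    (W W' : WeightedGraph.{w}) :
    bottleneckDist (p.ofWeighted W).diagram (p.ofWeighted W').diagram ≤
      WeightedGraph.naturalPseudodist W W' := by
  refine le_iInf fun ψ => le_of_forall_gt fun d hd => ?_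
  -- Two intermediate values are needed: `d''` becomes the speed `k` of the path, positive even when
  -- the weights agree, and `d'` the larger bound `h`.
  obtain ⟨d', hd', hd'd⟩ := exists_between hd
  obtain ⟨d'', hd'', hd''d⟩ := exists_between hd'
  have hfin : d' ≠ ⊤ := (hd'd.trans_le le_top).ne
  have hfin' : d'' ≠ ⊤ := (hd''d.trans_le le_top).ne
  have hk : 0 < d''.toReal := ENNReal.toReal_pos (bot_le.trans_lt hd'').ne' hfin'
  have hkh : d''.toReal < d'.toReal := (ENNReal.toReal_lt_toReal hfin' hfin).2 hd''d
  choose V χ hV h0 h1 using WeightedGraph.exists_interpolation W W' ψ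
  have hdiff : ∀ e, |W.weight e - W'.weight (ψ.mapEdgeSet e)| ≤ d''.toReal := fun e => by
    rw [← ENNReal.ofReal_le_iff_le_toReal hfin']
    exact (le_iSup (fun e => ENNReal.ofReal |W.weight e - W'.weight (ψ.mapEdgeSet e)|) e).trans
      hd''.le
  have main := CategoricalPersistenceFunction.bottleneckDist_le_of_path
    (q := fun t => p.ofWeighted (V t)) hk hkh fun s t _ _ _ _ η hη hle =>
      hp.interleaved ((χ t).symm.trans (χ s)) hη
        (WeightedGraph.weightDiff_symm_trans_le _ _ fun e => by
          rw [hV, hV]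
          have : (1 - t) * W.weight e + t * W'.weight (ψ.mapEdgeSet e) -
              ((1 - s) * W.weight e + s * W'.weight (ψ.mapEdgeSet e)) =
              (s - t) * (W.weight e - W'.weight (ψ.mapEdgeSet e)) := by ring
          rw [this, abs_mul]
          exact (mul_le_mul_of_nonneg_left (hdiff e) (abs_nonneg _)).trans hle)
  simp only [h0 0 rfl, h1 1 rfl, ENNReal.ofReal_toReal hfin] at main
  exact main.trans_lt hd'd
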